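/- **Theorem 3.1 (Multivariate PGF).** Let $J$ be a number of infinite-server queues. Batches arrive at the points $T_1,T_2,\dots$ of a non-homogeneous Poisson process on $[0,\infty)$ with rate $\lambda(t)\ge 0$, integrable on bounded intervals. The $i$-th batch brings $\Sigma_{ij}$ customers to queue $j$, where the vectors $\mathbf\Sigma_i=(\Sigma_{i1},\dots,\Sigma_{iJ})\in\mathbb{Z}_{\ge0}^J$ are i.i.d. copies of a random vector $\mathbf S=(S_1,\dots,S_J)$. The $\ell$-th customer of batch $i$ entering queue $j$ carries a stochastic process $X^j_{i,\ell}(s)$, $s\ge 0$, which equals $k$ if this customer is in queue $k\in\{1,\dots,J\}$ at time $T_i+s$ (and takes another value if the customer has left the network), with $P(X^j_{i,\ell}(s)=k)=q^j_k(s)$; each process is jointly measurable with respect to time and the $\sigma$-algebra that it generates itself (this holds for example if its paths are right-continuous). The arrival process, all batch sizes and all routes $X^j_{i,\ell}$ are mutually independent. Let $N_k(t)$ be the number of customers in queue $k$ at time $t\ge 0$, and $\mathbf N(t)=(N_1(t),\dots,N_J(t))$. For a random vector $\mathbf Y\in\mathbb{Z}_{\ge0}^J$ write $G_{\mathbf Y}(z)=E\big[\prod_j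 z_j^{Y_j}\big]$ and let $\mathcal D_{\mathbf Y}\subseteq\mathbb C^J$ be the set of $z$ for which this expectation converges absolutely. For $z\in\mathbb C^J$ put $$w_j(s,z)=1+\sum_{k=1}^J (z_k-1)\,q^j_k(s),\qquad w(s,z)=(w_1(s,z),\dots,w_J(s,z)),\qquad |z|=(|z_1|,\dots,|z_J|).$$ Then for every $t\ge0$ almost surely only finitely many batches arrive in $[0,t]$, and the following hold. 1. For every $z\in\mathcal D_{\mathbf N(t)}$, we have $w(t-\tau,z)\in\mathcal D_{\mathbf S}$ for almost every $\tau\in[0,t]$ with $\lambda(\tau)\neq0$, the integral below converges absolutely, and $$E\Big[\prod_{k=1}^J z_k^{N_k(t)}\Big]=\exp\Big\{-\int_0^t\lambda(\tau)\Big[1-G_{\mathbf S}\Big(1+\sum_{k=1}^J(z_k-1)q^1_k(t-\tau),\dots,1+\sum_{k=1}^J(z_k-1)q^J_k(t-\tau)\Big)\Big]d\tau\Big\}.$$ 2. $\mathcal D_{\mathbf N(t)}$ contains the closed unit polydisc $\{|z_k|\le1 \text{ for all } k\}$ and, more generally, each polydisc $\{|z_k|\le r \text{ for all } k\}$ with $r\ge1$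 and $(r,\dots,r)\in\mathcal D_{\mathbf S}$. 3. For every $z\in\mathbb C^J$: $z\in\mathcal D_{\mathbf N(t)}$ if and only if $w(t-\tau,|z|)\in\mathcal D_{\mathbf S}$ for almost every $\tau\in[0,t]$ with $\lambda(\tau)\neq 0$ and $\int_0^t\lambda(\tau)\,G_{\mathbf S}(w(t-\tau,|z|))\,d\tau<\infty$. -/

import Mathlib

open MeasureTheory ProbabilityTheory Set
open scoped NNReal ENNReal

noncomputable section

namespace QueueNetwork

/-- The domain of the multivariate probability generating function of the random vector `Y`: the
points `z` of `ℂ^J` at which the expectation of `∏ j, z j ^ Y j` converges (absolutely). -/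
def pgfDomain {Ω : Type*} [MeasurableSpace Ω] {J : ℕ} (μ : Measure Ω) (Y : Ω → Fin J → ℕ) :
    Set (Fin J → ℂ) :=
  {z | Integrable (fun ω => ∏ j, z j ^ Y ω j) μ}

/-- The multivariate probability generating function `z ↦ E[∏ j, z j ^ Y j]`
(meaningful on `pgfDomain μ Y`). -/
def pgf {Ω : Type*} [MeasurableSpace Ω] {J : ℕ} (μ : Measure Ω) (Y : Ω → Fin J → ℕ)
    (z : Fin J → ℂ) : ℂ :=
  ∫ ω, ∏ j, z j ^ Y ω j ∂μ

/-- The number of points `T i` that lie in the set `A` of nonnegative reals. The value `T i ω = ∞`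
means that there is no `i`-th point. -/
def pointCount {Ω : Type*} (T : ℕ → Ω → ℝ≥0∞) (A : Set ℝ) (ω : Ω) : ℕ∞ :=
  Set.encard {i | T i ω ∈ ENNReal.ofReal '' A}

/-- `T 0, T 1, …` are the points of a non-homogeneous Poisson process on `[0, ∞)` with intensity
`rate`: the numbers of points in disjoint bounded Borel sets `A m` are independent, and the number
in `A m` is Poisson with mean `∫ τ in A m, rate τ`. The points may be listed in any order, and
there may be finitely many of them (the remaining `T i` are `∞`). -/
structure IsPoissonProcess {Ω : Type*} [MeasurableSpace Ω] (μ : Measure Ω) (rate : ℝ → ℝ)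
    (T : ℕ → Ω → ℝ≥0∞) : Prop where
  measurable : ∀ i, Measurable (T i)
  law : ∀ (n : ℕ) (A : Fin n → Set ℝ) (b : ℝ) (k : Fin n → ℕ),
    (∀ m, MeasurableSet (A m)) → (∀ m, A m ⊆ Icc 0 b) → (Pairwise fun m m' => Disjoint (A m) (A m')) →
    μ.real (⋂ m, {ω | pointCount T (A m) ω = (k m : ℕ∞)}) =
      ∏ m, (Real.exp (-∫ τ in A m, rate τ) * (∫ τ in A m, rate τ) ^ (k m) / (k m).factorial)

/-- The σ-algebra generated by the process `Y`, whose value `some k` says that the customer is in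
queue `k` and whose value `none` says that the customer has left the network. -/
def processSigma {Ω : Type*} {J : ℕ} (Y : ℝ≥0 → Ω → Option (Fin J)) : MeasurableSpace Ω :=
  MeasurableSpace.generateFrom {E | ∃ (s : ℝ≥0) (k : Fin J), E = {ω | Y s ω = some k}}

/-- The independent sources of randomness in the network: the arrival process, the size of the
`i`-th batch, and the route of the `l`-th customer who enters queue `j` with the `i`-th batch. -/
inductive Source (J : ℕ) : Type
  | arrivals : Source J
  | batch (i : ℕ) : Source J
  | route (i : ℕ) (j : Fin J) (l : ℕ) : Source J

/-- The σ-algebra generated by each source of randomness. -/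
def sourceSigma {Ω : Type*} {J : ℕ} (T : ℕ → Ω → ℝ≥0∞) (B : ℕ → Ω → Fin J → ℕ)
    (X : ℕ → Fin J → ℕ → ℝ≥0 → Ω → Option (Fin J)) : Source J → MeasurableSpace Ω
  | .arrivals => MeasurableSpace.comap (fun ω i => T i ω) MeasurableSpace.pi
  | .batch i => MeasurableSpace.comap (B i) MeasurableSpace.pi
  | .route i j l => processSigma (X i j l)

/-- An open network of `J` infinite-server queues with multivariate batch Poisson arrivals.
* The batches arrive at the points `T i` of a Poisson process with intensity `rate`.
* `B i ω j` is the number of customers whom the `i`-th batch brings to queue `j`; the vectors `B i`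
  have the common law `ν`.
* `X i j l s ω` is the place, at time `s` after arrival, of the `l`-th customer (counted from `0`)
  who enters queue `j` with the `i`-th batch. The process `X i j l` is jointly measurable in
  time and in the randomness that it generates itself (as every process with
  right-continuous paths is), and it is in queue `k` at time `s` with probability `q j k s`.
* The arrival process, all batch sizes and all routes are independent. -/
structure IsBatchNetwork {Ω : Type*} [MeasurableSpace Ω] {J : ℕ} (μ : Measure Ω) (rate : ℝ → ℝ)
    (ν : Measure (Fin J → ℕ)) (q : Fin J → Fin J → ℝ → ℝ)
    (T : ℕ → Ω → ℝ≥0∞) (B : ℕ → Ω → Fin J → ℕ)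
    (X : ℕ → Fin J → ℕ → ℝ≥0 → Ω → Option (Fin J)) : Prop where
  arrivals : IsPoissonProcess μ rate T
  measurable_batch : ∀ i, Measurable (B i)
  law_batch : ∀ i, μ.map (B i) = ν
  measurable_route : ∀ i j l s k, MeasurableSet {ω | X i j l s ω = some k}
  jointly_measurable_route : ∀ i j l k,
    MeasurableSet[MeasurableSpace.prod inferInstance (processSigma (X i j l))]
      {p : ℝ≥0 × Ω | X i j l p.1 p.2 = some k}
  law_route : ∀ (i : ℕ) (j : Fin J) (l : ℕ) (s : ℝ≥0) (k : Fin J),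
    μ.real {ω | X i j l s ω = some k} = q j k s
  indep : iIndep (sourceSigma T B X) μ

/-- The number of customers from the `i`-th batch who are in queue `k` at time `s` after the
arrival of the batch. -/
def batchOccupancy {Ω : Type*} {J : ℕ} (B : ℕ → Ω → Fin J → ℕ)
    (X : ℕ → Fin J → ℕ → ℝ≥0 → Ω → Option (Fin J)) (i : ℕ) (s : ℝ≥0) (ω : Ω) (k : Fin J) : ℕ :=
  ∑ j, ∑ l ∈ Finset.range (B i ω j), if X i j l s ω = some k then 1 else 0

/-- The occupancy vector `N(t)`: the `k`-th component is the number of customers in queue `k` at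
time `t`, summed over the batches that have arrived by time `t`. -/
def occupancy {Ω : Type*} {J : ℕ} (T : ℕ → Ω → ℝ≥0∞) (B : ℕ → Ω → Fin J → ℕ)
    (X : ℕ → Fin J → ℕ → ℝ≥0 → Ω → Option (Fin J)) (t : ℝ≥0) (ω : Ω) (k : Fin J) : ℕ :=
  ∑ᶠ i ∈ {i | T i ω ≤ (t : ℝ≥0∞)}, batchOccupancy B X i (t - (T i ω).toNNReal) ω k

/-- The vector with `j`-th component `1 + ∑ k, (z k - 1) * q j k s`. -/
def routed {J : ℕ} (q : Fin J → Fin J → ℝ → ℝ) (s : ℝ) (z : Fin J → ℂ) : Fin J → ℂ :=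
  fun j => 1 + ∑ k, (z k - 1) * (q j k s : ℂ)

end QueueNetwork

end

/-! Condition on the arrival times, which are independent of batch sizes and routes. Given the
times, distinct batches are independent, so `E[z^N(t)]` is the mean of `∏ g(T_i)` over the points in
`[0, t]`, where `g(x)` is the generating function at time `t` of one batch arriving at `x`. Given
its size, a batch consists of independent customers, and one entering queue `j` contributes the mean
factor `w_j(t - x, z)`; hence `g(x) = G_S(w(t - x, z))`. For a Poisson process with finite mean
measure `Λ` the mean of `∏ g(T_i)` is `exp ∫ (g - 1) dΛ`, and `Λ` has density `rate` on `[0, t]`.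

The Poisson formula (`HasPoissonCounts.integral_prod`) holds for simple `g` because the counts on
its level sets are independent Poisson variables; it passes to integrable `g` by dominated
convergence. The dominating product comes from `HasPoissonCounts.lintegral_prod_lt_top_iff`: for `g`
with values in `[0, ∞]`, the mean of the product is finite exactly when `∫ g dΛ` is.

This criterion also gives the domain. By Tonelli, `E|z^N(t)|` is a mean of the same kind with `g`
replaced by `batchMass`. As a customer occupies at most one queue, the absolute value of its factor
is its factor at `|z|`, so on `[0, t]` the mass is the absolute moment of `ν` at `w(t - x, |z|)`.
Since `w_j(s, |z|)` is real, nonnegative and at least `|w_j(s, z)|`, convergence at `|z|` controls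
convergence at `z`.

Conditioning is expressed through laws on a product space: `identDistrib_prod_of_indep` resamples
one independent source, after which Fubini applies. -/

noncomputable section

namespace QueueNetwork

open Filter Topology

/-! ### Indices and counts of the points in `[0, t]` -/

/-- The finite set of indices of the points of `τ` that lie in `[0, t]`
(and `∅` if there are infinitely many such points). -/
def arrived (t : ℝ≥0) (τ : ℕ → ℝ≥0∞) : Finset ℕ :=
  open Classical in if h : {i | τ i ≤ (t : ℝ≥0∞)}.Finite then h.toFinset else ∅

lemma mem_arrived {t : ℝ≥0} {τ : ℕ → ℝ≥0∞} (h : {i | τ i ≤ (t : ℝ≥0∞)}.Finite) {i : ℕ} :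
    i ∈ arrived t τ ↔ τ i ≤ t := by
  simp [arrived, h]

lemma coe_arrived {t : ℝ≥0} {τ : ℕ → ℝ≥0∞} (h : {i | τ i ≤ (t : ℝ≥0∞)}.Finite) :
    (arrived t τ : Set ℕ) = {i | τ i ≤ (t : ℝ≥0∞)} := by
  ext i; simp [mem_arrived h]

lemma le_of_mem_arrived {t : ℝ≥0} {τ : ℕ → ℝ≥0∞} {i : ℕ} (hi : i ∈ arrived t τ) :
    τ i ≤ t := by
  by_cases h : {i | τ i ≤ (t : ℝ≥0∞)}.Finite
  · exact (mem_arrived h).1 hi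
  · simp [arrived, h] at hi

lemma measurableSet_arrivals_eq {α : Type*} [MeasurableSpace α] {T : ℕ → α → ℝ≥0∞}
    (hT : ∀ i, Measurable (T i)) (t : ℝ≥0) (F : Finset ℕ) :
    MeasurableSet {a | {i | T i a ≤ (t : ℝ≥0∞)} = F} := by
  have : {a | {i | T i a ≤ (t : ℝ≥0∞)} = F} = ⋂ i, {a | T i a ≤ t ↔ i ∈ F} := by
    ext a; simp [Set.ext_iff]
  rw [this]
  refine MeasurableSet.iInter fun i => ?_
  by_cases hi : i ∈ F
  · simpa [hi] using measurableSet_le (hT i) measurable_const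
  · simpa [hi] using measurableSet_lt measurable_const (hT i)

lemma measurableSet_finite_arrivals {α : Type*} [MeasurableSpace α] {T : ℕ → α → ℝ≥0∞}
    (hT : ∀ i, Measurable (T i)) (t : ℝ≥0) :
    MeasurableSet {a | {i | T i a ≤ (t : ℝ≥0∞)}.Finite} := by
  have : {a | {i | T i a ≤ (t : ℝ≥0∞)}.Finite} =
      ⋃ F : Finset ℕ, {a | {i | T i a ≤ (t : ℝ≥0∞)} = F} := by
    ext a
    simp only [mem_iUnion]
    exact ⟨fun h => ⟨h.toFinset, by simp⟩, fun ⟨F, (hF : _ = _)⟩ => by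
      change Set.Finite _; rw [hF]; exact F.finite_toSet⟩
  rw [this]
  exact MeasurableSet.iUnion fun F => measurableSet_arrivals_eq hT t F

lemma measurableSet_arrived_eq {α : Type*} [MeasurableSpace α] {T : ℕ → α → ℝ≥0∞}
    (hT : ∀ i, Measurable (T i)) (t : ℝ≥0) (F : Finset ℕ) :
    MeasurableSet {a | arrived t (fun i => T i a) = F} := by
  -- The default value `∅` puts all configurations with infinitely many points into the fibre over
  -- `∅`.
  have : {a | arrived t (fun i => T i a) = F} =
      {a | {i | T i a ≤ (t : ℝ≥0∞)} = F} ∪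
        ({a | {i | T i a ≤ (t : ℝ≥0∞)}.Finite}ᶜ ∩ {_a | F = ∅}) := by
    ext a
    by_cases h : {i | T i a ≤ (t : ℝ≥0∞)}.Finite
    · have h' := coe_arrived h
      simp only [mem_ofPred_eq, mem_union, mem_inter_iff, mem_compl_iff, h, not_true, false_and,
        or_false]
      rw [← h', Finset.coe_inj]
    · have h' : {i | T i a ≤ (t : ℝ≥0∞)} ≠ F := fun e => h (e ▸ F.finite_toSet)
      simp [arrived, h, h', eq_comm (a := ∅)]
  rw [this]
  exact (measurableSet_arrivals_eq hT t F).union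
    ((measurableSet_finite_arrivals hT t).compl.inter (.const _))

/-- A function that depends measurably on `a` for each value of a countable-valued measurable
index is measurable. -/
lemma measurable_of_countable_index {α ι γ : Type*} [MeasurableSpace α] [Countable ι]
    [MeasurableSpace γ] {I : α → ι} {f : ι → α → γ} (hI : ∀ i, MeasurableSet {a | I a = i})
    (hf : ∀ i, Measurable (f i)) : Measurable fun a => f (I a) a := by
  intro s hs
  have : (fun a => f (I a) a) ⁻¹' s = ⋃ i, {a | I a = i} ∩ f i ⁻¹' s := by
    ext a; simp
  rw [this]
  exact MeasurableSet.iUnion fun i => (hI i).inter (hf i hs)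

lemma measurable_prod_arrived {α M : Type*} [MeasurableSpace α] [CommMonoid M] [MeasurableSpace M]
    [MeasurableMul₂ M] {T : ℕ → α → ℝ≥0∞} (hT : ∀ i, Measurable (T i)) (t : ℝ≥0) {g : ℝ → M}
    (hg : Measurable g) :
    Measurable fun a => ∏ i ∈ arrived t (fun i => T i a), g (T i a).toReal :=
  measurable_of_countable_index (f := fun F a => ∏ i ∈ F, g (T i a).toReal)
    (measurableSet_arrived_eq hT t)
    fun F => Finset.measurable_fun_prod F fun i _ => hg.comp (hT i).ennreal_toReal

/-- The number of points in `A`, among the finitely many points in `[0, t]`. -/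
def arrivedCount (t : ℝ≥0) (τ : ℕ → ℝ≥0∞) (A : Set ℝ) : ℕ :=
  open Classical in ((arrived t τ).filter fun i => (τ i).toReal ∈ A).card

lemma measurable_arrivedCount {α : Type*} [MeasurableSpace α] {T : ℕ → α → ℝ≥0∞}
    (hT : ∀ i, Measurable (T i)) (t : ℝ≥0) {A : Set ℝ} (hA : MeasurableSet A) :
    Measurable fun a => arrivedCount t (fun i => T i a) A := by
  classical
  refine measurable_of_countable_index
    (f := fun F a => (F.filter fun i => (T i a).toReal ∈ A).card)
    (measurableSet_arrived_eq hT t) fun F => ?_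
  simp_rw [Finset.card_filter]
  exact Finset.measurable_fun_sum F fun i _ =>
    Measurable.ite ((hT i).ennreal_toReal hA) measurable_const measurable_const

lemma pointCount_eq_arrivedCount {Ω : Type*} {T : ℕ → Ω → ℝ≥0∞} {t : ℝ≥0} {ω : Ω}
    (h : {i | T i ω ≤ (t : ℝ≥0∞)}.Finite) {A : Set ℝ} (hA : A ⊆ Icc 0 t) :
    pointCount T A ω = arrivedCount t (fun i => T i ω) A := by
  classical
  rw [pointCount, arrivedCount, ← Set.encard_coe_eq_coe_finsetCard]
  congr 1
  ext i
  simp only [mem_ofPred_eq, mem_image, Finset.coe_filter, mem_arrived h]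
  constructor
  · rintro ⟨x, hx, hxi⟩
    rw [← hxi]
    refine ⟨?_, by rwa [ENNReal.toReal_ofReal (hA hx).1]⟩
    rw [ENNReal.ofReal_le_iff_le_toReal (by simp)]
    exact (hA hx).2
  · rintro ⟨h1, h2⟩
    exact ⟨_, h2, ENNReal.ofReal_toReal (ne_top_of_le_ne_top (by simp) h1)⟩

lemma pointCount_Icc {Ω : Type*} (T : ℕ → Ω → ℝ≥0∞) (t : ℝ≥0) (ω : Ω) :
    pointCount T (Icc 0 t) ω = {i | T i ω ≤ (t : ℝ≥0∞)}.encard := by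
  rw [pointCount]
  congr 1
  ext i
  simp only [mem_ofPred_eq, mem_image]
  constructor
  · rintro ⟨x, hx, hxi⟩
    rw [← hxi, ENNReal.ofReal_le_iff_le_toReal (by simp)]
    exact hx.2
  · intro h
    have h' : T i ω ≠ ∞ := ne_top_of_le_ne_top (by simp) h
    exact ⟨(T i ω).toReal, ⟨by simp, ENNReal.toReal_le_of_le_ofReal t.2 (by simpa using h)⟩,
      ENNReal.ofReal_toReal h'⟩

/-! ### Poisson counts and the probability generating functional -/

/-- The numbers of points in disjoint Borel subsets of `[0, t]` are independent Poisson variables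
with means given by `Λ`. -/
def HasPoissonCounts {Ω : Type*} [MeasurableSpace Ω] (μ : Measure Ω) (T : ℕ → Ω → ℝ≥0∞) (t : ℝ≥0)
    (Λ : Measure ℝ) : Prop :=
  ∀ (n : ℕ) (A : Fin n → Set ℝ) (k : Fin n → ℕ), (∀ m, MeasurableSet (A m)) →
    (∀ m, A m ⊆ Icc 0 t) → (Pairwise fun m m' => Disjoint (A m) (A m')) →
    μ.real (⋂ m, {ω | pointCount T (A m) ω = (k m : ℕ∞)}) =
      ∏ m, (Real.exp (-Λ.real (A m)) * Λ.real (A m) ^ (k m) / (k m).factorial)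

namespace HasPoissonCounts

variable {Ω : Type*} [MeasurableSpace Ω] {μ : Measure Ω} [IsProbabilityMeasure μ]
  {T : ℕ → Ω → ℝ≥0∞} {t : ℝ≥0} {Λ : Measure ℝ}

/-- The law prescribes only the probabilities of finite counts. On `[0, t]` these are Poisson
masses, which sum to 1, so no mass is left for an infinite count. -/
lemma ae_finite (h : HasPoissonCounts μ T t Λ) (hT : ∀ i, Measurable (T i)) :
    ∀ᵐ ω ∂μ, {i | T i ω ≤ (t : ℝ≥0∞)}.Finite := by
  set r : ℝ≥0 := (Λ (Icc 0 t)).toNNReal with hr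
  let E : ℕ → Set Ω := fun k => {ω | {i | T i ω ≤ (t : ℝ≥0∞)}.encard = k}
  have hE : ∀ k, E k = {ω | {i | T i ω ≤ (t : ℝ≥0∞)}.Finite} ∩
      {ω | (arrived t fun i => T i ω).card = k} := by
    intro k
    ext ω
    constructor
    · intro (hω : _ = _)
      have hfin : {i | T i ω ≤ (t : ℝ≥0∞)}.Finite := Set.finite_of_encard_eq_coe hω
      refine ⟨hfin, ?_⟩
      rw [← coe_arrived hfin, Set.encard_coe_eq_coe_finsetCard] at hω
      exact_mod_cast hω
    · rintro ⟨hfin, hk : _ = _⟩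
      change Set.encard _ = _
      rw [← coe_arrived hfin, Set.encard_coe_eq_coe_finsetCard, hk]
  have hEm : ∀ k, MeasurableSet (E k) := fun k => by
    rw [hE]
    refine (measurableSet_finite_arrivals hT t).inter ?_
    exact measurable_of_countable_index (f := fun F (_ : Ω) => F.card)
      (measurableSet_arrived_eq hT t) (fun F => measurable_const) (measurableSet_singleton k)
  have hμE : ∀ k, μ (E k) = poissonMeasure r {k} := by
    intro k
    have := h 1 (fun _ => Icc 0 t) (fun _ => k) (fun _ => measurableSet_Icc) (fun _ => le_rfl)
      (fun i j hij => (hij (Subsingleton.elim i j)).elim)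
    simp only [pointCount_Icc, Finset.univ_unique, Finset.prod_singleton, iInter_const] at this
    rw [poissonMeasure_singleton, ← ofReal_measureReal]
    congr 1
  have hdisj : Pairwise (Function.onFun Disjoint E) := by
    intro a b hab
    refine Set.disjoint_left.2 fun ω (h1 : _ = _) (h2 : _ = _) => hab ?_
    exact_mod_cast h1.symm.trans h2
  have hU : μ (⋃ k, E k) = 1 := by
    rw [measure_iUnion hdisj hEm]
    simp_rw [hμE]
    rw [← measure_iUnion (by intro a b hab; simpa [Function.onFun] using hab)
      (fun k => measurableSet_singleton k), Set.iUnion_of_singleton, measure_univ]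
  have := (prob_compl_eq_zero_iff (MeasurableSet.iUnion hEm)).2 hU
  rw [← mem_ae_iff] at this
  filter_upwards [this] with ω hω
  obtain ⟨k, hk : _ = _⟩ := mem_iUnion.1 hω
  exact Set.finite_of_encard_eq_coe hk

lemma map_arrivedCount (h : HasPoissonCounts μ T t Λ) (hT : ∀ i, Measurable (T i)) {n : ℕ}
    {A : Fin n → Set ℝ} (hA : ∀ m, MeasurableSet (A m)) (hAt : ∀ m, A m ⊆ Icc 0 t)
    (hd : Pairwise fun m m' => Disjoint (A m) (A m')) :
    μ.map (fun ω m => arrivedCount t (fun i => T i ω) (A m)) =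
      Measure.pi fun m => poissonMeasure (Λ (A m)).toNNReal := by
  refine Measure.ext_of_singleton fun k => ?_
  rw [Measure.map_apply (measurable_pi_lambda _ fun m => measurable_arrivedCount hT t (hA m))
    (measurableSet_singleton k), Measure.pi_singleton]
  have h1 : ((fun ω m => arrivedCount t (fun i => T i ω) (A m)) ⁻¹' {k} : Set Ω) =ᵐ[μ]
      ⋂ m, {ω | pointCount T (A m) ω = (k m : ℕ∞)} := by
    filter_upwards [h.ae_finite hT] with ω hω
    refine propext ?_
    change (fun m => arrivedCount t (fun i => T i ω) (A m)) = k ↔ ω ∈ ⋂ m, _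
    simp [pointCount_eq_arrivedCount hω (hAt _), funext_iff]
  rw [measure_congr h1, ← ofReal_measureReal, h n A k hA hAt hd, ENNReal.ofReal_prod_of_nonneg]
  · exact Finset.prod_congr rfl fun m _ => by rw [poissonMeasure_singleton]; rfl
  · intro m _
    have : 0 ≤ Λ.real (A m) := measureReal_nonneg
    positivity

lemma _root_.ProbabilityTheory.integral_pow_poissonMeasure (r : ℝ≥0) (c : ℂ) :
    ∫ n, c ^ n ∂(poissonMeasure r) = Complex.exp (r * (c - 1)) := by
  rw [integral_poissonMeasure, mul_sub, mul_one, sub_eq_add_neg, add_comm, Complex.exp_add,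
    Complex.exp_eq_exp_ℂ, congrFun (NormedSpace.exp_eq_tsum_div (𝔸 := ℂ)) (r * c),
    ← Complex.exp_eq_exp_ℂ, ← tsum_mul_left]
  refine tsum_congr fun n => ?_
  rw [Complex.real_smul]
  push_cast
  ring

/-- Grouping the points by the value `c` of `g` turns the product into `∏ c ^ N(A_c)` with
independent Poisson counts. Each factor has mean `exp (Λ(A_c) (c - 1))`, and the exponents add up to
`∫ (g - 1) dΛ`. -/
lemma integral_prod_simpleFunc [IsFiniteMeasure Λ] (h : HasPoissonCounts μ T t Λ)
    (hT : ∀ i, Measurable (T i)) (hΛ : Λ (Icc 0 t)ᶜ = 0) (g : SimpleFunc ℝ ℂ) :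
    ∫ ω, ∏ i ∈ arrived t (fun i => T i ω), g (T i ω).toReal ∂μ =
      Complex.exp (∫ x, (g x - 1) ∂Λ) := by
  classical
  let e := g.range.equivFin.symm
  -- Level sets are cut down to `[0, t]`, where the law of the counts is available; this loses
  -- neither points nor `Λ`-mass.
  let A : Fin g.range.card → Set ℝ := fun m => g ⁻¹' {(e m : ℂ)} ∩ Icc 0 t
  have hA : ∀ m, MeasurableSet (A m) := fun m =>
    (g.measurableSet_preimage _).inter measurableSet_Icc
  have hd : Pairwise fun m m' => Disjoint (A m) (A m') := by
    intro a b hab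
    refine Set.disjoint_left.2 fun x hx hx' => hab ?_
    have h1 : g x = e a := hx.1
    have h2 : g x = e b := hx'.1
    exact e.injective (Subtype.ext (h1.symm.trans h2))
  have key : ∀ ω, ∏ i ∈ arrived t (fun i => T i ω), g (T i ω).toReal =
      ∏ m, (e m : ℂ) ^ arrivedCount t (fun i => T i ω) (A m) := by
    intro ω
    rw [← Finset.prod_fiberwise_of_maps_to (t := g.range) (g := fun i => g (T i ω).toReal)
      (fun i _ => g.mem_range_self _), ← Finset.prod_coe_sort, ← e.prod_comp]
    refine Finset.prod_congr rfl fun m _ => ?_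
    rw [Finset.prod_congr rfl (g := fun _ => (e m : ℂ)), Finset.prod_const, arrivedCount]
    · refine congrArg (fun s : Finset ℕ => (e m : ℂ) ^ s.card) ?_
      ext i
      simp only [Finset.mem_filter]
      refine and_congr_right fun hi => ?_
      have := le_of_mem_arrived hi
      simp only [A, mem_inter_iff, mem_preimage, mem_singleton_iff, mem_Icc,
        ENNReal.toReal_nonneg, true_and]
      refine ⟨fun h => ⟨h, ENNReal.toReal_le_of_le_ofReal t.2 (by simpa using this)⟩, And.left⟩
    · intro i hi
      exact (Finset.mem_filter.1 hi).2
  simp_rw [key]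
  have hmeas : Measurable (fun ω m => arrivedCount t (fun i => T i ω) (A m)) :=
    measurable_pi_lambda _ fun m => measurable_arrivedCount hT t (hA m)
  have := integral_map (μ := μ) (φ := fun ω m => arrivedCount t (fun i => T i ω) (A m))
    (f := fun k => ∏ m, (e m : ℂ) ^ k m) hmeas.aemeasurable
    (Measurable.of_discrete.aestronglyMeasurable)
  rw [← this, h.map_arrivedCount hT hA (fun m => inter_subset_right) hd,
    integral_fintype_prod_eq_prod (f := fun m (k : ℕ) => (e m : ℂ) ^ k)]
  simp_rw [integral_pow_poissonMeasure]
  rw [← Complex.exp_sum]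
  congr 1
  have hint : Integrable g Λ := g.integrable_of_isFiniteMeasure
  have hsum := SimpleFunc.integral_eq Λ (g.map (fun c => c - 1))
  have hcomp : ∀ m, Λ.real (A m) = Λ.real (g ⁻¹' {(e m : ℂ)}) := by
    intro m
    refine measureReal_congr ?_
    have : ∀ᵐ x ∂Λ, x ∈ Icc (0 : ℝ) t := hΛ
    filter_upwards [this] with x hx
    refine propext ⟨fun h => h.1, fun h => ⟨h, hx⟩⟩
  have e1 : ∫ x, g x ∂Λ = ∑ m, (Λ.real (A m) : ℂ) * e m := by
    rw [← SimpleFunc.integral_eq_integral g hint, SimpleFunc.integral_eq, ← Finset.sum_coe_sort,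
      ← e.sum_comp]
    refine Finset.sum_congr rfl fun m _ => ?_
    rw [hcomp, Complex.real_smul]
  have e2 : (Λ.real univ : ℂ) = ∑ m, (Λ.real (A m) : ℂ) := by
    rw [← Complex.ofReal_sum]
    congr 1
    simp_rw [hcomp]
    rw [e.sum_comp (fun c => Λ.real (g ⁻¹' {(c : ℂ)})),
      Finset.sum_coe_sort g.range (fun c => Λ.real (g ⁻¹' {c})),
      sum_measureReal_preimage_singleton _ fun y _ => g.measurableSet_preimage _]
    congr 1
    ext x
    simp
  rw [integral_sub hint (integrable_const _), integral_const, e1, Complex.real_smul, e2, mul_one,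
    ← Finset.sum_sub_distrib]
  exact Finset.sum_congr rfl fun m _ => by rw [mul_sub, mul_one]; rfl

end HasPoissonCounts

namespace HasPoissonCounts

variable {Ω : Type*} [MeasurableSpace Ω] {μ : Measure Ω} [IsProbabilityMeasure μ]
  {T : ℕ → Ω → ℝ≥0∞} {t : ℝ≥0} {Λ : Measure ℝ}

lemma lintegral_prod_simpleFunc [IsFiniteMeasure Λ] (h : HasPoissonCounts μ T t Λ)
    (hT : ∀ i, Measurable (T i)) (hΛ : Λ (Icc 0 t)ᶜ = 0) (g : SimpleFunc ℝ ℝ≥0∞)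
    (hg : ∀ x, g x ≠ ∞) :
    ∫⁻ ω, ∏ i ∈ arrived t (fun i => T i ω), g (T i ω).toReal ∂μ =
      ENNReal.ofReal (Real.exp ((∫⁻ x, g x ∂Λ).toReal - Λ.real univ)) := by
  let f : SimpleFunc ℝ ℂ := g.map fun y => (y.toReal : ℂ)
  have hf : ∀ x, f x = ((g x).toReal : ℂ) := fun x => rfl
  have key := h.integral_prod_simpleFunc hT hΛ f
  -- A non-integrable function has Bochner integral 0 by convention, but this integral is an
  -- exponential, hence nonzero.
  have hint : Integrable (fun ω => ∏ i ∈ arrived t (fun i => T i ω), f (T i ω).toReal) μ := by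
    by_contra hcon
    rw [integral_undef hcon] at key
    exact Complex.exp_ne_zero _ key.symm
  have e1 : ∀ ω, ∏ i ∈ arrived t (fun i => T i ω), f (T i ω).toReal =
      ((∏ i ∈ arrived t (fun i => T i ω), (g (T i ω).toReal).toReal : ℝ) : ℂ) := fun ω => by
    simp [hf]
  simp_rw [e1] at key hint
  have hint' : Integrable
      (fun ω => ∏ i ∈ arrived t (fun i => T i ω), (g (T i ω).toReal).toReal) μ := by
    exact hint.re.congr (Eventually.of_forall fun ω => Complex.ofReal_re _)
  have e2 : ∫ x, (f x - 1) ∂Λ = (((∫⁻ x, g x ∂Λ).toReal - Λ.real univ : ℝ) : ℂ) := by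
    rw [integral_sub f.integrable_of_isFiniteMeasure (integrable_const _), integral_const]
    simp_rw [hf]
    rw [integral_complex_ofReal, integral_toReal g.measurable.aemeasurable
      (Eventually.of_forall fun x => (hg x).lt_top)]
    simp
  rw [integral_complex_ofReal, e2, ← Complex.ofReal_exp, Complex.ofReal_inj] at key
  rw [← key, ofReal_integral_eq_lintegral_ofReal hint'
    (Eventually.of_forall fun ω => Finset.prod_nonneg fun i _ => ENNReal.toReal_nonneg)]
  refine lintegral_congr fun ω => ?_
  rw [ENNReal.ofReal_prod_of_nonneg fun i _ => ENNReal.toReal_nonneg]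
  exact Finset.prod_congr rfl fun i _ => (ENNReal.ofReal_toReal (hg _)).symm

/-- Monotonicity lets the two indices be replaced by their maximum. -/
lemma _root_.ENNReal.iSup_mul_iSup_of_monotone {a b : ℕ → ℝ≥0∞} (ha : Monotone a)
    (hb : Monotone b) : (⨆ n, a n) * (⨆ n, b n) = ⨆ n, a n * b n := by
  refine le_antisymm ?_ (ENNReal.iSup_mul_le)
  rw [ENNReal.iSup_mul]
  refine iSup_le fun n => ?_
  rw [ENNReal.mul_iSup]
  refine iSup_le fun m => ?_
  exact (mul_le_mul' (ha (le_max_left n m)) (hb (le_max_right n m))).trans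
    (le_iSup (fun k => a k * b k) (max n m))

lemma _root_.ENNReal.prod_iSup_of_monotone {ι : Type*} (s : Finset ι) {a : ι → ℕ → ℝ≥0∞}
    (ha : ∀ i, Monotone (a i)) : ∏ i ∈ s, ⨆ n, a i n = ⨆ n, ∏ i ∈ s, a i n := by
  classical
  induction s using Finset.induction_on with
  | empty => simp
  | insert i s hi ih =>
    simp_rw [Finset.prod_insert hi]
    rw [ih, ENNReal.iSup_mul_iSup_of_monotone (ha i)]
    exact fun m n hmn => Finset.prod_le_prod' fun j _ => ha j hmn

/-- The multiplicative functional of a Poisson process has a finite mean if and only if the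
function is integrable with respect to the mean measure. -/
lemma lintegral_prod_lt_top_iff [IsFiniteMeasure Λ] (h : HasPoissonCounts μ T t Λ)
    (hT : ∀ i, Measurable (T i)) (hΛ : Λ (Icc 0 t)ᶜ = 0) {g : ℝ → ℝ≥0∞} (hg : Measurable g) :
    ∫⁻ ω, ∏ i ∈ arrived t (fun i => T i ω), g (T i ω).toReal ∂μ < ∞ ↔ ∫⁻ x, g x ∂Λ < ∞ := by
  have hmono : ∀ x, Monotone fun n => SimpleFunc.eapprox g n x := fun x m n hmn =>
    SimpleFunc.monotone_eapprox g hmn x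
  -- Simple functions increasing to `g` have increasing products, so monotone convergence carries
  -- the formula for simple functions to the limit.
  have hL : ∫⁻ ω, ∏ i ∈ arrived t (fun i => T i ω), g (T i ω).toReal ∂μ =
      ⨆ n, ENNReal.ofReal
        (Real.exp ((∫⁻ x, SimpleFunc.eapprox g n x ∂Λ).toReal - Λ.real univ)) := by
    simp_rw [← fun n => h.lintegral_prod_simpleFunc hT hΛ (SimpleFunc.eapprox g n)
      (fun x => (SimpleFunc.eapprox_lt_top g n x).ne)]
    rw [← lintegral_iSup]
    · refine lintegral_congr fun ω => ?_
      rw [← ENNReal.prod_iSup_of_monotone _ fun i => hmono _]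
      simp_rw [SimpleFunc.iSup_eapprox_apply hg]
    · exact fun n => measurable_prod_arrived hT t (SimpleFunc.measurable _)
    · exact fun m n hmn ω => Finset.prod_le_prod' fun i _ => hmono _ hmn
  have hR : ∫⁻ x, g x ∂Λ = ⨆ n, ∫⁻ x, SimpleFunc.eapprox g n x ∂Λ := by
    rw [← lintegral_iSup (fun n => SimpleFunc.measurable _) fun m n hmn x => hmono x hmn]
    simp_rw [SimpleFunc.iSup_eapprox_apply hg]
  have hfin : ∀ n, ∫⁻ x, SimpleFunc.eapprox g n x ∂Λ ≠ ∞ := fun n => by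
    rw [SimpleFunc.lintegral_eq_lintegral, SimpleFunc.lintegral]
    exact ENNReal.sum_ne_top.2 fun y hy => by
      obtain ⟨x, rfl⟩ := SimpleFunc.mem_range.1 hy
      exact ENNReal.mul_ne_top (SimpleFunc.eapprox_lt_top g n x).ne (measure_ne_top _ _)
  rw [hL]
  constructor
  · intro hlt
    set M := (⨆ n, ENNReal.ofReal
        (Real.exp ((∫⁻ x, SimpleFunc.eapprox g n x ∂Λ).toReal - Λ.real univ))) with hM
    rw [hR]
    refine lt_of_le_of_lt (iSup_le fun n => ?_) (ENNReal.ofReal_lt_top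
      (r := M.toReal + Λ.real univ))
    rw [← ENNReal.ofReal_toReal (hfin n)]
    refine ENNReal.ofReal_le_ofReal ?_
    have h1 : ENNReal.ofReal
        (Real.exp ((∫⁻ x, SimpleFunc.eapprox g n x ∂Λ).toReal - Λ.real univ)) ≤ M :=
      le_iSup (fun n => ENNReal.ofReal
        (Real.exp ((∫⁻ x, SimpleFunc.eapprox g n x ∂Λ).toReal - Λ.real univ))) n
    rw [ENNReal.ofReal_le_iff_le_toReal hlt.ne] at h1
    -- The inequality `x + 1 ≤ exp x` turns the bound `M` on the exponentials into a bound on the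
    -- integrals uniform in `n`.
    linarith [Real.add_one_le_exp ((∫⁻ x, SimpleFunc.eapprox g n x ∂Λ).toReal - Λ.real univ)]
  · intro hlt
    refine lt_of_le_of_lt (iSup_le fun n => ENNReal.ofReal_le_ofReal (Real.exp_le_exp.2
      (sub_le_sub_right (ENNReal.toReal_mono hlt.ne ?_) _))) (ENNReal.ofReal_lt_top
        (r := Real.exp ((∫⁻ x, g x ∂Λ).toReal - Λ.real univ)))
    rw [hR]
    exact le_iSup (fun n => ∫⁻ x, SimpleFunc.eapprox g n x ∂Λ) n

/-- The probability generating functional of a Poisson process. -/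
lemma integral_prod [IsFiniteMeasure Λ] (h : HasPoissonCounts μ T t Λ)
    (hT : ∀ i, Measurable (T i)) (hΛ : Λ (Icc 0 t)ᶜ = 0) {g : ℝ → ℂ} (hg : Measurable g)
    (hgi : Integrable g Λ) :
    ∫ ω, ∏ i ∈ arrived t (fun i => T i ω), g (T i ω).toReal ∂μ =
      Complex.exp (∫ x, (g x - 1) ∂Λ) := by
  let f : ℕ → SimpleFunc ℝ ℂ := fun n => SimpleFunc.approxOn g hg univ 0 (mem_univ _) n
  have hlim : ∀ x, Tendsto (fun n => f n x) atTop (𝓝 (g x)) := fun x =>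
    SimpleFunc.tendsto_approxOn hg _ (by simp)
  have hbound : ∀ n x, ‖f n x‖ ≤ 2 * ‖g x‖ := fun n x =>
    (SimpleFunc.norm_approxOn_zero_le hg (mem_univ _) x n).trans_eq (two_mul _).symm
  -- The factor 2 per point gives no uniform constant, as the number of points is unbounded. Yet `2
  -- * ‖g‖` is still `Λ`-integrable, so the finiteness criterion covers the whole product.
  have hdom : Integrable
      (fun ω => ∏ i ∈ arrived t (fun i => T i ω), (2 * ‖g (T i ω).toReal‖)) μ := by
    have hm : Measurable fun x => 2 * ‖g x‖ := hg.norm.const_mul 2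
    refine ⟨(measurable_prod_arrived hT t hm).aestronglyMeasurable, ?_⟩
    have := (h.lintegral_prod_lt_top_iff hT hΛ (g := fun x => ‖2 * ‖g x‖‖ₑ) hm.enorm).2
      (hgi.norm.const_mul 2).2
    refine lt_of_le_of_lt (lintegral_mono fun ω => ?_) this
    simp only [enorm_eq_nnnorm, nnnorm_prod, ENNReal.ofNNReal_finsetProd]
    exact le_rfl
  have hl : Tendsto (fun n => ∫ ω, ∏ i ∈ arrived t (fun i => T i ω), f n (T i ω).toReal ∂μ) atTop
      (𝓝 (∫ ω, ∏ i ∈ arrived t (fun i => T i ω), g (T i ω).toReal ∂μ)) := by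
    refine tendsto_integral_of_dominated_convergence _
      (fun n => (measurable_prod_arrived hT t (f n).measurable).aestronglyMeasurable) hdom
      (fun n => Eventually.of_forall fun ω => ?_)
      (Eventually.of_forall fun ω => tendsto_finsetProd _ fun i _ => hlim _)
    rw [norm_prod]
    exact Finset.prod_le_prod (fun i _ => norm_nonneg _) fun i _ => hbound n _
  have hr : Tendsto (fun n => ∫ x, (f n x - 1) ∂Λ) atTop (𝓝 (∫ x, (g x - 1) ∂Λ)) := by
    refine tendsto_integral_of_dominated_convergence (fun x => 2 * ‖g x‖ + 1)
      (fun n => ((f n).measurable.sub measurable_const).aestronglyMeasurable)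
      ((hgi.norm.const_mul 2).add (integrable_const _))
      (fun n => Eventually.of_forall fun x => ?_)
      (Eventually.of_forall fun x => (hlim x).sub_const 1)
    refine (norm_sub_le _ _).trans ?_
    simpa using hbound n x
  simp_rw [fun n => h.integral_prod_simpleFunc hT hΛ (f n)] at hl
  exact tendsto_nhds_unique hl ((Complex.continuous_exp.tendsto _).comp hr)

end HasPoissonCounts

/-! ### Independence and resampling -/

section Independence

variable {Ω : Type*} {m0 : MeasurableSpace Ω} {μ : Measure Ω}

/-- The joint law of independent variables is the product of their laws, which is also the joint law
of the two copies on `Ω × Ω`. -/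
lemma identDistrib_prod_of_indepFun {α β γ : Type*} [MeasurableSpace α] [MeasurableSpace β]
    [MeasurableSpace γ] [IsProbabilityMeasure μ] {f : Ω → α} {g : Ω → β} (hf : Measurable f)
    (hg : Measurable g) (hfg : IndepFun f g μ) {Φ : α × β → γ} (hΦ : Measurable Φ) :
    IdentDistrib (fun ω => Φ (f ω, g ω)) (fun p : Ω × Ω => Φ (f p.1, g p.2)) μ (μ.prod μ) := by
  have h2 : Measurable fun p : Ω × Ω => (f p.1, g p.2) :=
    (hf.comp measurable_fst).prodMk (hg.comp measurable_snd)
  refine ⟨(hΦ.comp (hf.prodMk hg)).aemeasurable, (hΦ.comp h2).aemeasurable, ?_⟩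
  change μ.map (Φ ∘ fun ω => (f ω, g ω)) = (μ.prod μ).map (Φ ∘ fun p => (f p.1, g p.2))
  rw [← Measure.map_map hΦ (hf.prodMk hg), ← Measure.map_map hΦ h2,
    (indepFun_iff_map_prod_eq_prod_map_map hf.aemeasurable hg.aemeasurable).1 hfg,
    Measure.map_prod_map μ μ hf hg]
  rfl

/-- Induction on the finite family: the new group is independent of the σ-algebra generated by the
union of the other index sets, since it is disjoint from that union. -/
lemma iIndep_iSup_of_disjoint {ι κ : Type*} {m : ι → MeasurableSpace Ω} (hle : ∀ i, m i ≤ m0)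
    (h : iIndep m μ) {S : κ → Set ι} (hS : Pairwise fun a b => Disjoint (S a) (S b)) :
    iIndep (fun k => ⨆ i ∈ S k, m i) μ := by
  classical
  have := h.isProbabilityMeasure
  rw [iIndep_iff]
  intro s f
  induction s using Finset.induction_on with
  | empty => simp
  | insert a s ha ih =>
    intro hf
    rw [Finset.set_biInter_insert, Finset.prod_insert ha,
      ← ih fun i hi => hf i (Finset.mem_insert_of_mem hi)]
    have hd : Disjoint (S a) (⋃ k ∈ s, S k) := by
      simp only [disjoint_iUnion_right]
      exact fun k hk => hS fun e => ha (e ▸ hk)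
    refine (Indep_iff _ _ _).1 (indep_iSup_of_disjoint hle h hd) _ _
      (hf a (Finset.mem_insert_self _ _)) ?_
    refine Finset.measurableSet_biInter s fun k hk => ?_
    refine (iSup₂_le fun i hi => ?_ : (⨆ i ∈ S k, m i) ≤ _) _ (hf k (Finset.mem_insert_of_mem hk))
    exact le_iSup₂_of_le i (mem_biUnion hk hi) le_rfl

lemma iIndepFun_of_iIndep {ι : Type*} {β : ι → Type*} [mβ : ∀ i, MeasurableSpace (β i)]
    {m : ι → MeasurableSpace Ω} (h : iIndep m μ) {f : ∀ i, Ω → β i}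
    (hf : ∀ i, Measurable[m i] (f i)) : iIndepFun f μ := by
  rw [iIndepFun_iff_iIndep]
  exact iIndep_of_iIndep_of_le h fun i => (hf i).comap_le

lemma integral_finset_prod_of_iIndepFun {ι : Type*} (s : Finset ι) {f : ι → Ω → ℂ}
    (h : iIndepFun f μ) (hf : ∀ i, Measurable (f i)) :
    ∫ ω, ∏ i ∈ s, f i ω ∂μ = ∏ i ∈ s, ∫ ω, f i ω ∂μ := by
  have h' : iIndepFun (fun i : s => f i) μ := h.precomp Subtype.val_injective
  have := h'.integral_fun_prod_eq_prod_integral fun i => (hf i).aestronglyMeasurable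
  rw [← Finset.prod_coe_sort, ← this]
  refine integral_congr_ae (Eventually.of_forall fun ω => ?_)
  exact (Finset.prod_coe_sort s fun i => f i ω).symm

end Independence

/-- If `f` is independent of the σ-algebra `m`, then the second argument of a function of `f` and
of `m`-measurable randomness may be resampled independently. -/
lemma identDistrib_prod_of_indep {Ω α γ : Type*} [mα : MeasurableSpace α]
    [MeasurableSpace γ] {m m0 : MeasurableSpace Ω} {μ : Measure Ω} [IsProbabilityMeasure μ] (hm : m ≤ m0) {f : Ω → α} (hf : Measurable f)
    (hfm : Indep (mα.comap f) m μ) {Φ : α × Ω → γ} (hΦ : Measurable[mα.prod m] Φ) :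
    IdentDistrib (fun ω => Φ (f ω, ω)) (fun p : Ω × Ω => Φ (f p.1, p.2)) μ (μ.prod μ) := by
  -- The second variable is the identity from `Ω` to `Ω` with the smaller σ-algebra `m`; the
  -- σ-algebra it generates is `m`.
  refine @identDistrib_prod_of_indepFun Ω m0 μ α Ω γ mα m _ _ f id hf (measurable_id'' hm) ?_ Φ hΦ
  refine (IndepFun_iff_Indep (mγ := m) f id μ).2 ?_
  rwa [MeasurableSpace.comap_id]

/-! ### The contribution of a single customer -/

section Customers

variable {Ω : Type*} {J : ℕ}

/-- The factor `∏ k, z k ^ 1{x = k}` that a customer at the place `x` contributes. -/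
def placeWeight (z : Fin J → ℂ) (x : Option (Fin J)) : ℂ :=
  ∏ k, z k ^ (if x = some k then 1 else 0)

/-- At most one of the indicators is nonzero, which makes the product affine in `z`. -/
lemma placeWeight_eq (z : Fin J → ℂ) (x : Option (Fin J)) :
    placeWeight z x = 1 + ∑ k, (z k - 1) * (if x = some k then 1 else 0) := by
  cases x with
  | none => simp [placeWeight]
  | some k => simp [placeWeight]

lemma norm_placeWeight (z : Fin J → ℂ) (x : Option (Fin J)) :
    (‖placeWeight z x‖ : ℂ) = placeWeight (fun k => (‖z k‖ : ℂ)) x := by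
  simp only [placeWeight, norm_prod, norm_pow, Complex.ofReal_prod, Complex.ofReal_pow]

/-- The number of customers in queue `k` at time `s` after the arrival of the `i`-th batch, if this
batch brings `b j` customers to queue `j`. -/
def placed (X : ℕ → Fin J → ℕ → ℝ≥0 → Ω → Option (Fin J)) (i : ℕ) (b : Fin J → ℕ) (s : ℝ≥0)
    (ω : Ω) (k : Fin J) : ℕ :=
  ∑ j, ∑ l ∈ Finset.range (b j), if X i j l s ω = some k then 1 else 0

lemma prod_pow_placed (X : ℕ → Fin J → ℕ → ℝ≥0 → Ω → Option (Fin J)) (i : ℕ) (b : Fin J → ℕ)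
    (s : ℝ≥0) (ω : Ω) (z : Fin J → ℂ) :
    ∏ k, z k ^ placed X i b s ω k =
      ∏ p ∈ Finset.univ.sigma fun j => Finset.range (b j), placeWeight z (X i p.1 p.2 s ω) := by
  simp_rw [placed, placeWeight, Finset.prod_sigma, ← Finset.prod_pow_eq_pow_sum]
  rw [Finset.prod_comm]
  exact Finset.prod_congr rfl fun j _ => Finset.prod_comm

lemma measurable_comp_place [MeasurableSpace Ω] {γ : Type*} [MeasurableSpace γ]
    {Y : Ω → Option (Fin J)} (hY : ∀ k, MeasurableSet {ω | Y ω = some k})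
    (f : Option (Fin J) → γ) : Measurable fun ω => f (Y ω) := by
  refine measurable_of_countable_index (f := fun x _ => f x) (fun x => ?_)
    fun x => measurable_const
  cases x with
  | some k => exact hY k
  | none =>
    have : {ω | Y ω = none} = (⋃ k, {ω | Y ω = some k})ᶜ := by
      ext ω
      cases h : Y ω <;> simp [h]
    rw [this]
    exact (MeasurableSet.iUnion hY).compl

lemma measurable_placed [MeasurableSpace Ω] {α : Type*} [MeasurableSpace α]
    {X : ℕ → Fin J → ℕ → ℝ≥0 → Ω → Option (Fin J)} {i : ℕ}
    (hX : ∀ j l k, MeasurableSet {p : ℝ≥0 × Ω | X i j l p.1 p.2 = some k})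
    {b : α → Fin J → ℕ} (hb : Measurable b) {s : α → ℝ≥0} (hs : Measurable s) {o : α → Ω}
    (ho : Measurable o) : Measurable fun a => placed X i (b a) (s a) (o a) := by
  refine measurable_of_countable_index (f := fun n a => placed X i n (s a) (o a))
    (fun n => hb (measurableSet_singleton n)) fun n => measurable_pi_lambda _ fun k => ?_
  refine Finset.measurable_fun_sum _ fun j _ => Finset.measurable_fun_sum _ fun l _ => ?_
  exact Measurable.ite ((hs.prodMk ho) (hX j l k)) measurable_const measurable_const

end Customers

/-! ### Joint measurability of batch occupancies -/

section Measurability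

variable {Ω : Type*} {J : ℕ} {B : ℕ → Ω → Fin J → ℕ}
  {X : ℕ → Fin J → ℕ → ℝ≥0 → Ω → Option (Fin J)}

lemma measurableSet_processSigma {Y : ℝ≥0 → Ω → Option (Fin J)} (s : ℝ≥0) (k : Fin J) :
    MeasurableSet[processSigma Y] {ω | Y s ω = some k} :=
  MeasurableSpace.measurableSet_generateFrom ⟨s, k, rfl⟩

lemma measurableSet_prod_of_le {α : Type*} [MeasurableSpace α] {m m' : MeasurableSpace Ω}
    (hm : m ≤ m') {S : Set (α × Ω)} (hS : MeasurableSet[MeasurableSpace.prod inferInstance m] S) :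
    MeasurableSet[MeasurableSpace.prod inferInstance m'] S :=
  sup_le_sup_left (MeasurableSpace.comap_mono hm) _ _ hS

/-- The `i`-th batch and the routes of its customers. -/
def batchSources (J i : ℕ) : Set (Source J) :=
  {a | a = Source.batch i ∨ ∃ j l, a = Source.route i j l}

lemma measurable_batchOccupancy {T : ℕ → Ω → ℝ≥0∞} {i : ℕ} [m : MeasurableSpace Ω]
    (hX : ∀ j l k, MeasurableSet[MeasurableSpace.prod inferInstance (processSigma (X i j l))]
      {p : ℝ≥0 × Ω | X i j l p.1 p.2 = some k})
    (hm : ∀ a ∈ batchSources J i, sourceSigma T B X a ≤ m) {α : Type*} [MeasurableSpace α]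
    {s : α → ℝ≥0} (hs : Measurable s) {o : α → Ω} (ho : Measurable o) :
    Measurable fun a => batchOccupancy B X i (s a) (o a) := by
  have hB : Measurable (B i) := measurable_iff_comap_le.2 (hm (Source.batch i) (Or.inl rfl))
  exact measurable_placed (fun j l k => measurableSet_prod_of_le
    (hm (Source.route i j l) (Or.inr ⟨j, l, rfl⟩)) (hX j l k)) (hB.comp ho) hs ho

end Measurability

/-! ### The generating function of one batch -/

namespace IsBatchNetwork

variable {Ω : Type*} [m0 : MeasurableSpace Ω] {μ : Measure Ω} {J : ℕ}
  {rate : ℝ → ℝ} {ν : Measure (Fin J → ℕ)} {q : Fin J → Fin J → ℝ → ℝ} {T : ℕ → Ω → ℝ≥0∞}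
  {B : ℕ → Ω → Fin J → ℕ} {X : ℕ → Fin J → ℕ → ℝ≥0 → Ω → Option (Fin J)}


lemma sourceSigma_le (h : IsBatchNetwork μ rate ν q T B X) (a : Source J) :
    sourceSigma T B X a ≤ m0 := by
  cases a with
  | arrivals => exact (measurable_pi_lambda _ h.arrivals.measurable).comap_le
  | batch i => exact (h.measurable_batch i).comap_le
  | route i j l =>
    refine MeasurableSpace.generateFrom_le ?_
    rintro _ ⟨s, k, rfl⟩
    exact h.measurable_route i j l s k

lemma iIndepFun_places (h : IsBatchNetwork μ rate ν q T B X) (i : ℕ) (s : ℝ≥0) {γ : Type*}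
    [MeasurableSpace γ] (f : Option (Fin J) → γ) :
    iIndepFun (fun (p : (_ : Fin J) × ℕ) ω => f (X i p.1 p.2 s ω)) μ := by
  have hinj : Function.Injective fun p : (_ : Fin J) × ℕ => Source.route i p.1 p.2 := by
    rintro ⟨j, l⟩ ⟨j', l'⟩ e
    cases e
    rfl
  refine iIndepFun_of_iIndep (h.indep.precomp hinj) fun p => ?_
  exact @measurable_comp_place Ω J (processSigma (X i p.1 p.2)) γ _ _
    (fun k => measurableSet_processSigma s k) f

variable [IsProbabilityMeasure μ]

lemma integrable_place (h : IsBatchNetwork μ rate ν q T B X) (i : ℕ) (j : Fin J) (l : ℕ) (s : ℝ≥0)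
    (f : Option (Fin J) → ℂ) : Integrable (fun ω => f (X i j l s ω)) μ :=
  Integrable.of_bound
    (measurable_comp_place (h.measurable_route i j l s) f).aestronglyMeasurable
    (∑ x, ‖f x‖) (Eventually.of_forall fun _ =>
      Finset.single_le_sum (f := fun x => ‖f x‖) (fun _ _ => norm_nonneg _) (Finset.mem_univ _))

lemma integral_placeWeight (h : IsBatchNetwork μ rate ν q T B X) (i : ℕ) (j : Fin J) (l : ℕ)
    (s : ℝ≥0) (z : Fin J → ℂ) : ∫ ω, placeWeight z (X i j l s ω) ∂μ = routed q s z j := by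
  have hint : ∀ k, Integrable
      (fun ω => (z k - 1) * (if X i j l s ω = some k then (1 : ℂ) else 0)) μ := fun k =>
    h.integrable_place i j l s fun x => (z k - 1) * (if x = some k then 1 else 0)
  simp_rw [placeWeight_eq]
  rw [integral_add (integrable_const _) (integrable_finsetSum _ fun k _ => hint k),
    integral_finsetSum _ fun k _ => hint k, routed]
  simp only [integral_const, probReal_univ, one_smul, integral_const_mul]
  congr 1
  refine Finset.sum_congr rfl fun k _ => ?_
  rw [← h.law_route i j l s k]
  congr 1
  have := integral_indicator_one (μ := μ) (h.measurable_route i j l s k)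
  rw [← this, ← integral_complex_ofReal]
  refine integral_congr_ae (Eventually.of_forall fun ω => ?_)
  by_cases hk : X i j l s ω = some k <;> simp [hk]

/-- Taking absolute values of a customer's factor amounts to replacing `z` by `|z|`. In particular
`w_j(s, |z|)` is a nonnegative real, although `q` enters only as a function of time. Batch 0 and
customer 0 are an arbitrary choice. -/
lemma routed_norm_eq (h : IsBatchNetwork μ rate ν q T B X) (j : Fin J) (s : ℝ≥0)
    (z : Fin J → ℂ) : routed q s (fun k => (‖z k‖ : ℂ)) j =
      ((∫ ω, ‖placeWeight z (X 0 j 0 s ω)‖ ∂μ : ℝ) : ℂ) := by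
  rw [← h.integral_placeWeight 0 j 0, ← integral_complex_ofReal]
  simp_rw [norm_placeWeight]

lemma enorm_routed_norm (h : IsBatchNetwork μ rate ν q T B X) (i : ℕ) (j : Fin J) (l : ℕ)
    (s : ℝ≥0) (z : Fin J → ℂ) : ∫⁻ ω, ‖placeWeight z (X i j l s ω)‖ₑ ∂μ =
      ‖routed q s (fun k => (‖z k‖ : ℂ)) j‖ₑ := by
  have h1 : routed q s (fun k => (‖z k‖ : ℂ)) j =
      ((∫ ω, ‖placeWeight z (X i j l s ω)‖ ∂μ : ℝ) : ℂ) := by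
    rw [← h.integral_placeWeight i j l, ← integral_complex_ofReal]
    simp_rw [norm_placeWeight]
  rw [h1, ← ofReal_integral_norm_eq_lintegral_enorm (h.integrable_place i j l s _),
    ← ofReal_norm, Complex.norm_real, Real.norm_of_nonneg (by positivity)]

lemma norm_routed_le (h : IsBatchNetwork μ rate ν q T B X) (j : Fin J) (s : ℝ≥0)
    (z : Fin J → ℂ) : ‖routed q s z j‖ ≤ ‖routed q s (fun k => (‖z k‖ : ℂ)) j‖ := by
  rw [h.routed_norm_eq, ← h.integral_placeWeight 0 j 0, Complex.norm_real,
    Real.norm_of_nonneg (by positivity)]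
  exact norm_integral_le_integral_norm _

/-- For a fixed batch size the customers' factors are independent, and each of the `b j` customers
entering queue `j` has the same mean. -/
lemma lintegral_placed (h : IsBatchNetwork μ rate ν q T B X) (i : ℕ) (b : Fin J → ℕ) (s : ℝ≥0)
    (z : Fin J → ℂ) : ∫⁻ ω, ‖∏ k, z k ^ placed X i b s ω k‖ₑ ∂μ =
      ‖∏ j, routed q s (fun k => (‖z k‖ : ℂ)) j ^ b j‖ₑ := by
  simp_rw [prod_pow_placed, enorm_eq_nnnorm, nnnorm_prod, ENNReal.ofNNReal_finsetProd,
    ← enorm_eq_nnnorm]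
  rw [lintegral_prod_eq_prod_lintegral_of_indepFun _ _
    (h.iIndepFun_places i s fun x => ‖placeWeight z x‖ₑ)
    fun p => measurable_comp_place (h.measurable_route i p.1 p.2 s) fun x => ‖placeWeight z x‖ₑ]
  simp_rw [h.enorm_routed_norm, Finset.prod_sigma, Finset.prod_const, Finset.card_range]
  simp [enorm_pow]

lemma integral_placed (h : IsBatchNetwork μ rate ν q T B X) (i : ℕ) (b : Fin J → ℕ) (s : ℝ≥0)
    (z : Fin J → ℂ) : ∫ ω, ∏ k, z k ^ placed X i b s ω k ∂μ = ∏ j, routed q s z j ^ b j := by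
  simp_rw [prod_pow_placed]
  rw [integral_finset_prod_of_iIndepFun _ (h.iIndepFun_places i s (placeWeight z))
    fun p => measurable_comp_place (h.measurable_route i p.1 p.2 s) (placeWeight z)]
  simp_rw [h.integral_placeWeight, Finset.prod_sigma, Finset.prod_const, Finset.card_range]

/-- The size of the batch is independent of its routes, so integrals over the two can be taken one
after the other. -/
lemma identDistrib_batchOccupancy (h : IsBatchNetwork μ rate ν q T B X) (i : ℕ) (s : ℝ≥0) :
    IdentDistrib (fun ω => batchOccupancy B X i s ω)
      (fun p : Ω × Ω => placed X i (B i p.1) s p.2) μ (μ.prod μ) := by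
  let R : Set (Source J) := {a | ∃ j l, a = Source.route i j l}
  have hle : ∀ j l, processSigma (X i j l) ≤ ⨆ a ∈ R, sourceSigma T B X a := fun j l =>
    le_iSup₂_of_le (Source.route i j l) ⟨j, l, rfl⟩ le_rfl
  have hind : Indep (MeasurableSpace.comap (B i) MeasurableSpace.pi)
      (⨆ a ∈ R, sourceSigma T B X a) μ := by
    have := indep_iSup_of_disjoint h.sourceSigma_le h.indep
      (S := {Source.batch i}) (T := R) (by simp [R])
    simpa [sourceSigma] using this
  have hX := fun j l k => measurableSet_prod_of_le (hle j l) (h.jointly_measurable_route i j l k)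
  refine identDistrib_prod_of_indep (Φ := fun p : (Fin J → ℕ) × Ω => placed X i p.1 s p.2)
    (iSup₂_le fun a _ => h.sourceSigma_le a) (h.measurable_batch i) hind ?_
  -- Measurability is now read with respect to the σ-algebra of the routes instead of the ambient
  -- one.
  let _ := ⨆ a ∈ R, sourceSigma T B X a
  exact measurable_placed hX measurable_fst measurable_const measurable_snd

/-- The PGF of the batch occupancy, at absolute values. -/
lemma lintegral_batchOccupancy (h : IsBatchNetwork μ rate ν q T B X) (i : ℕ) (s : ℝ≥0)
    (z : Fin J → ℂ) : ∫⁻ ω, ‖∏ k, z k ^ batchOccupancy B X i s ω k‖ₑ ∂μ =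
      ∫⁻ n, ‖∏ j, routed q s (fun k => (‖z k‖ : ℂ)) j ^ n j‖ₑ ∂ν := by
  have hid := (h.identDistrib_batchOccupancy i s).comp
    (u := fun n : Fin J → ℕ => ‖∏ k, z k ^ n k‖ₑ) .of_discrete
  have := hid.lintegral_eq
  simp only [Function.comp_def] at this
  rw [this, lintegral_prod (fun p => ‖∏ k, z k ^ placed X i (B i p.1) s p.2 k‖ₑ)
    hid.aemeasurable_snd]
  simp_rw [h.lintegral_placed]
  rw [← h.law_batch i, lintegral_map .of_discrete (h.measurable_batch i)]

/-- The PGF of the batch occupancy. -/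
lemma integral_batchOccupancy (h : IsBatchNetwork μ rate ν q T B X) (i : ℕ) (s : ℝ≥0)
    (z : Fin J → ℂ)
    (hint : Integrable (fun ω => ∏ k, z k ^ batchOccupancy B X i s ω k) μ) :
    ∫ ω, ∏ k, z k ^ batchOccupancy B X i s ω k ∂μ = pgf ν id (routed q s z) := by
  have hid := (h.identDistrib_batchOccupancy i s).comp
    (u := fun n : Fin J → ℕ => ∏ k, z k ^ n k) .of_discrete
  have := hid.integral_eq
  simp only [Function.comp_def] at this
  rw [this, integral_prod (fun p => ∏ k, z k ^ placed X i (B i p.1) s p.2 k)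
    (hid.integrable_iff.1 hint)]
  simp_rw [h.integral_placed]
  rw [← h.law_batch i, pgf, integral_map (h.measurable_batch i).aemeasurable
    Measurable.of_discrete.aestronglyMeasurable]
  rfl

end IsBatchNetwork

/-! ### All batches, for given arrival times -/

section TotalOccupancy

variable {Ω : Type*} {J : ℕ} {B : ℕ → Ω → Fin J → ℕ}
  {X : ℕ → Fin J → ℕ → ℝ≥0 → Ω → Option (Fin J)}

/-- The occupancy vector at time `t` for given arrival times `τ`. -/
def totalOccupancy (B : ℕ → Ω → Fin J → ℕ) (X : ℕ → Fin J → ℕ → ℝ≥0 → Ω → Option (Fin J))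
    (t : ℝ≥0) (τ : ℕ → ℝ≥0∞) (ω : Ω) (k : Fin J) : ℕ :=
  ∑ i ∈ arrived t τ, batchOccupancy B X i (t - (τ i).toNNReal) ω k

lemma occupancy_eq_totalOccupancy {T : ℕ → Ω → ℝ≥0∞} {t : ℝ≥0} {ω : Ω}
    (h : {i | T i ω ≤ (t : ℝ≥0∞)}.Finite) :
    occupancy T B X t ω = totalOccupancy B X t (fun i => T i ω) ω := by
  ext k
  rw [occupancy, totalOccupancy, finsum_mem_eq_finite_toFinset_sum _ h]
  congr 1
  simp [arrived, h]

lemma prod_pow_totalOccupancy (t : ℝ≥0) (τ : ℕ → ℝ≥0∞) (ω : Ω) (z : Fin J → ℂ) :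
    ∏ k, z k ^ totalOccupancy B X t τ ω k =
      ∏ i ∈ arrived t τ, ∏ k, z k ^ batchOccupancy B X i (t - (τ i).toNNReal) ω k := by
  simp_rw [totalOccupancy, ← Finset.prod_pow_eq_pow_sum]
  exact Finset.prod_comm

lemma measurable_totalOccupancy {T : ℕ → Ω → ℝ≥0∞} [m : MeasurableSpace Ω]
    (hX : ∀ i j l k, MeasurableSet[MeasurableSpace.prod inferInstance (processSigma (X i j l))]
      {p : ℝ≥0 × Ω | X i j l p.1 p.2 = some k})
    (hm : ∀ i, ∀ a ∈ batchSources J i, sourceSigma T B X a ≤ m) (t : ℝ≥0) :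
    Measurable fun p : (ℕ → ℝ≥0∞) × Ω => totalOccupancy B X t p.1 p.2 := by
  have hτ : ∀ i, Measurable fun p : (ℕ → ℝ≥0∞) × Ω => p.1 i := fun i =>
    (measurable_pi_apply i).comp measurable_fst
  have hF : ∀ F : Finset ℕ, Measurable fun (p : (ℕ → ℝ≥0∞) × Ω) (k : Fin J) =>
      ∑ i ∈ F, batchOccupancy B X i (t - (p.1 i).toNNReal) p.2 k := fun F =>
    measurable_pi_lambda _ fun k => Finset.measurable_fun_sum F fun i _ =>
      (measurable_pi_apply k).comp (measurable_batchOccupancy (hX i) (hm i)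
        (measurable_const.sub (hτ i).ennreal_toNNReal) measurable_snd)
  exact measurable_of_countable_index (I := fun p : (ℕ → ℝ≥0∞) × Ω => arrived t p.1)
    (fun F => measurableSet_arrived_eq hτ t F) hF

end TotalOccupancy

namespace IsBatchNetwork

variable {Ω : Type*} [m0 : MeasurableSpace Ω] {μ : Measure Ω} {J : ℕ}
  {rate : ℝ → ℝ} {ν : Measure (Fin J → ℕ)} {q : Fin J → Fin J → ℝ → ℝ} {T : ℕ → Ω → ℝ≥0∞}
  {B : ℕ → Ω → Fin J → ℕ} {X : ℕ → Fin J → ℕ → ℝ≥0 → Ω → Option (Fin J)}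

/-- Distinct batches draw on disjoint sets of sources. -/
lemma iIndepFun_batchOccupancy (h : IsBatchNetwork μ rate ν q T B X) (s : ℕ → ℝ≥0) :
    iIndepFun (fun i ω => batchOccupancy B X i (s i) ω) μ := by
  have hd : Pairwise fun i i' => Disjoint (batchSources J i) (batchSources J i') := by
    intro i i' hi
    refine Set.disjoint_left.2 ?_
    rintro _ (rfl | ⟨j, l, rfl⟩) h'
    · simp [batchSources, hi] at h'
    · simp [batchSources, hi] at h'
  refine iIndepFun_of_iIndep (iIndep_iSup_of_disjoint h.sourceSigma_le h.indep hd) fun i => ?_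
  exact @measurable_batchOccupancy Ω J B X T i (⨆ a ∈ batchSources J i, sourceSigma T B X a)
    (h.jointly_measurable_route i) (fun a ha => le_iSup₂_of_le a ha le_rfl) Ω
    (⨆ a ∈ batchSources J i, sourceSigma T B X a) (fun _ => s i) measurable_const id measurable_id

/-- The generating function of the number of customers at time `t` from a batch that arrives
at time `x`. -/
def batchMean (μ : Measure Ω) (B : ℕ → Ω → Fin J → ℕ)
    (X : ℕ → Fin J → ℕ → ℝ≥0 → Ω → Option (Fin J)) (t : ℝ≥0) (z : Fin J → ℂ) (x : ℝ) : ℂ :=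
  ∫ ω, ∏ k, z k ^ batchOccupancy B X 0 (t - x.toNNReal) ω k ∂μ

/-- The absolute version of `batchMean`. -/
def batchMass (μ : Measure Ω) (B : ℕ → Ω → Fin J → ℕ)
    (X : ℕ → Fin J → ℕ → ℝ≥0 → Ω → Option (Fin J)) (t : ℝ≥0) (z : Fin J → ℂ) (x : ℝ) : ℝ≥0∞ :=
  ∫⁻ ω, ‖∏ k, z k ^ batchOccupancy B X 0 (t - x.toNNReal) ω k‖ₑ ∂μ

lemma measurable_batchOccupancy_time (h : IsBatchNetwork μ rate ν q T B X) (i : ℕ) (t : ℝ≥0) :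
    Measurable fun p : ℝ × Ω => batchOccupancy B X i (t - p.1.toNNReal) p.2 :=
  QueueNetwork.measurable_batchOccupancy (h.jointly_measurable_route i)
    (fun a _ => h.sourceSigma_le a)
    (measurable_const.sub (measurable_real_toNNReal.comp measurable_fst)) measurable_snd

lemma measurable_batchOccupancy_left (h : IsBatchNetwork μ rate ν q T B X) (i : ℕ) (s : ℝ≥0) :
    Measurable (batchOccupancy B X i s) :=
  QueueNetwork.measurable_batchOccupancy (h.jointly_measurable_route i)
    (fun a _ => h.sourceSigma_le a) measurable_const measurable_id

variable [IsProbabilityMeasure μ]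

/-- The arrival times are independent of all sizes and routes. Since the age of a batch is random,
this needs joint measurability in time and in the σ-algebra generated by the routes. -/
lemma identDistrib_occupancy (h : IsBatchNetwork μ rate ν q T B X) {t : ℝ≥0}
    (hfin : ∀ᵐ ω ∂μ, {i | T i ω ≤ (t : ℝ≥0∞)}.Finite) :
    IdentDistrib (occupancy T B X t)
      (fun p : Ω × Ω => totalOccupancy B X t (fun i => T i p.1) p.2) μ (μ.prod μ) := by
  let R : Set (Source J) := {a | a ≠ Source.arrivals}
  have hle : ∀ i, ∀ a ∈ batchSources J i,
      sourceSigma T B X a ≤ ⨆ a ∈ R, sourceSigma T B X a := fun i a ha =>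
    le_iSup₂_of_le a (by rcases ha with rfl | ⟨j, l, rfl⟩ <;> simp [R]) le_rfl
  have hind : Indep (MeasurableSpace.comap (fun ω i => T i ω) MeasurableSpace.pi)
      (⨆ a ∈ R, sourceSigma T B X a) μ := by
    have := indep_iSup_of_disjoint h.sourceSigma_le h.indep
      (S := {Source.arrivals}) (T := R) (by simp [R])
    simpa [sourceSigma] using this
  have hid := identDistrib_prod_of_indep
    (Φ := fun p : (ℕ → ℝ≥0∞) × Ω => totalOccupancy B X t p.1 p.2)
    (iSup₂_le fun a _ => h.sourceSigma_le a) (measurable_pi_lambda _ h.arrivals.measurable) hind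
    (@measurable_totalOccupancy Ω J B X T (⨆ a ∈ R, sourceSigma T B X a)
      h.jointly_measurable_route hle t)
  -- The finitely supported sum in `occupancy` equals the sum over `arrived` only almost surely,
  -- which is enough for its a.e. measurability and its law.
  refine (IdentDistrib.of_ae_eq hid.aemeasurable_fst ?_).symm.trans hid
  filter_upwards [hfin] with ω hω using (occupancy_eq_totalOccupancy hω).symm

/-- Nothing is assumed about the regularity of `q`. Measurability in the arrival time comes from
integrating a jointly measurable function over `Ω`, which is why `batchMean` is an expectation and
not `G_S(w)`. -/
lemma measurable_batchMean (h : IsBatchNetwork μ rate ν q T B X) (t : ℝ≥0) (z : Fin J → ℂ) :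
    Measurable (batchMean μ B X t z) := by
  have hm : Measurable fun p : ℝ × Ω =>
      ∏ k, z k ^ batchOccupancy B X 0 (t - p.1.toNNReal) p.2 k :=
    (Measurable.of_discrete (f := fun n : Fin J → ℕ => ∏ k, z k ^ n k)).comp
      (h.measurable_batchOccupancy_time 0 t)
  exact hm.stronglyMeasurable.integral_prod_right.measurable

lemma measurable_batchMass (h : IsBatchNetwork μ rate ν q T B X) (t : ℝ≥0) (z : Fin J → ℂ) :
    Measurable (batchMass μ B X t z) := by
  have hm : Measurable fun p : ℝ × Ω =>
      ‖∏ k, z k ^ batchOccupancy B X 0 (t - p.1.toNNReal) p.2 k‖ₑ :=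
    (Measurable.of_discrete (f := fun n : Fin J → ℕ => ‖∏ k, z k ^ n k‖ₑ)).comp
      (h.measurable_batchOccupancy_time 0 t)
  exact hm.lintegral_prod_right'

lemma integrable_batchOccupancy_iff (h : IsBatchNetwork μ rate ν q T B X) (i : ℕ) (s : ℝ≥0)
    (z : Fin J → ℂ) : Integrable (fun ω => ∏ k, z k ^ batchOccupancy B X i s ω k) μ ↔
      routed q s (fun k => (‖z k‖ : ℂ)) ∈ pgfDomain ν id := by
  have hm : Measurable fun ω => ∏ k, z k ^ batchOccupancy B X i s ω k :=
    (Measurable.of_discrete (f := fun n : Fin J → ℕ => ∏ k, z k ^ n k)).comp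
      (h.measurable_batchOccupancy_left i s)
  have e := h.lintegral_batchOccupancy i s z
  constructor
  · intro hi
    exact ⟨Measurable.of_discrete.aestronglyMeasurable, lt_of_eq_of_lt e.symm hi.2⟩
  · intro hi
    exact ⟨hm.aestronglyMeasurable, lt_of_eq_of_lt e hi.2⟩

lemma integral_batchOccupancy_eq (h : IsBatchNetwork μ rate ν q T B X) (i : ℕ) (t : ℝ≥0)
    (z : Fin J → ℂ) (x : ℝ) :
    ∫ ω, ∏ k, z k ^ batchOccupancy B X i (t - x.toNNReal) ω k ∂μ = batchMean μ B X t z x := by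
  rw [batchMean]
  by_cases hz : routed q (t - x.toNNReal : ℝ≥0) (fun k => (‖z k‖ : ℂ)) ∈ pgfDomain ν id
  · rw [h.integral_batchOccupancy _ _ _ ((h.integrable_batchOccupancy_iff _ _ _).2 hz),
      h.integral_batchOccupancy _ _ _ ((h.integrable_batchOccupancy_iff _ _ _).2 hz)]
  -- Outside the domain both integrals are 0 by convention, so the identity holds for every `x`.
  · rw [integral_undef (mt (h.integrable_batchOccupancy_iff _ _ _).1 hz),
      integral_undef (mt (h.integrable_batchOccupancy_iff _ _ _).1 hz)]

lemma lintegral_batchOccupancy_eq (h : IsBatchNetwork μ rate ν q T B X) (i : ℕ) (t : ℝ≥0)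
    (z : Fin J → ℂ) (x : ℝ) :
    ∫⁻ ω, ‖∏ k, z k ^ batchOccupancy B X i (t - x.toNNReal) ω k‖ₑ ∂μ = batchMass μ B X t z x := by
  rw [batchMass, h.lintegral_batchOccupancy, h.lintegral_batchOccupancy]

lemma lintegral_totalOccupancy (h : IsBatchNetwork μ rate ν q T B X) (t : ℝ≥0) (τ : ℕ → ℝ≥0∞)
    (z : Fin J → ℂ) : ∫⁻ ω, ‖∏ k, z k ^ totalOccupancy B X t τ ω k‖ₑ ∂μ =
      ∏ i ∈ arrived t τ, batchMass μ B X t z (τ i).toReal := by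
  have hi := (h.iIndepFun_batchOccupancy fun i => t - (τ i).toNNReal).comp
    (fun _ (n : Fin J → ℕ) => ‖∏ k, z k ^ n k‖ₑ) fun _ => .of_discrete
  simp only [Function.comp_def] at hi
  have := lintegral_prod_eq_prod_lintegral_of_indepFun (arrived t τ) _ hi fun i =>
    (Measurable.of_discrete (f := fun n : Fin J → ℕ => ‖∏ k, z k ^ n k‖ₑ)).comp
      (h.measurable_batchOccupancy_left i (t - (τ i).toNNReal))
  have e : ∀ ω, ‖∏ k, z k ^ totalOccupancy B X t τ ω k‖ₑ = ∏ i ∈ arrived t τ,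
      ‖∏ k, z k ^ batchOccupancy B X i (t - (τ i).toNNReal) ω k‖ₑ := fun ω => by
    rw [prod_pow_totalOccupancy, enorm_eq_nnnorm, nnnorm_prod, ENNReal.ofNNReal_finsetProd]
    rfl
  simp_rw [e, this]
  refine Finset.prod_congr rfl fun i _ => ?_
  rw [← h.lintegral_batchOccupancy_eq i, ENNReal.toReal, Real.toNNReal_coe]

lemma integral_totalOccupancy (h : IsBatchNetwork μ rate ν q T B X) (t : ℝ≥0) (τ : ℕ → ℝ≥0∞)
    (z : Fin J → ℂ) : ∫ ω, ∏ k, z k ^ totalOccupancy B X t τ ω k ∂μ =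
      ∏ i ∈ arrived t τ, batchMean μ B X t z (τ i).toReal := by
  have hi := (h.iIndepFun_batchOccupancy fun i => t - (τ i).toNNReal).comp
    (fun _ (n : Fin J → ℕ) => ∏ k, z k ^ n k) fun _ => .of_discrete
  simp only [Function.comp_def] at hi
  have := integral_finset_prod_of_iIndepFun (arrived t τ) hi fun i =>
    (Measurable.of_discrete (f := fun n : Fin J → ℕ => ∏ k, z k ^ n k)).comp
      (h.measurable_batchOccupancy_left i (t - (τ i).toNNReal))
  simp_rw [prod_pow_totalOccupancy, this]
  refine Finset.prod_congr rfl fun i _ => ?_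
  rw [← h.integral_batchOccupancy_eq i, ENNReal.toReal, Real.toNNReal_coe]

end IsBatchNetwork

/-! ### The mean measure and integrals against the rate -/

/-- The mean measure on `[0, t]` of a Poisson process with intensity `rate`. -/
def meanMeasure (rate : ℝ → ℝ) (t : ℝ≥0) : Measure ℝ :=
  (volume.restrict (Icc (0 : ℝ) t)).withDensity fun x => ((rate x).toNNReal : ℝ≥0∞)

section MeanMeasure

variable {rate : ℝ → ℝ} {t : ℝ≥0}

lemma meanMeasure_compl : meanMeasure rate t (Icc 0 (t : ℝ))ᶜ = 0 :=
  withDensity_absolutelyContinuous _ _ (by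
    rw [Measure.restrict_apply measurableSet_Icc.compl]; simp)

lemma ae_meanMeasure_mem : ∀ᵐ x ∂(meanMeasure rate t), x ∈ Icc (0 : ℝ) t :=
  meanMeasure_compl

lemma integrableOn_rate (hint : IntervalIntegrable rate volume 0 t) :
    IntegrableOn rate (Icc 0 (t : ℝ)) :=
  (intervalIntegrable_iff_integrableOn_Icc_of_le t.2).1 hint

lemma aemeasurable_rate (hint : IntervalIntegrable rate volume 0 t) :
    AEMeasurable (fun x => (rate x).toNNReal) (volume.restrict (Icc (0 : ℝ) t)) :=
  (integrableOn_rate hint).aemeasurable.real_toNNReal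

lemma meanMeasure_apply (h0 : ∀ x, 0 ≤ x → 0 ≤ rate x) (hint : IntervalIntegrable rate volume 0 t)
    {A : Set ℝ} (hA : MeasurableSet A) (hAt : A ⊆ Icc 0 (t : ℝ)) :
    meanMeasure rate t A = ENNReal.ofReal (∫ x in A, rate x) := by
  rw [meanMeasure, withDensity_apply _ hA, Measure.restrict_restrict hA,
    inter_eq_self_of_subset_left hAt,
    ofReal_integral_eq_lintegral_ofReal ((integrableOn_rate hint).mono_set hAt)]
  · rfl
  · exact (ae_restrict_iff' hA).2 (Eventually.of_forall fun x hx => h0 x (hAt hx).1)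

lemma isFiniteMeasure_meanMeasure (h0 : ∀ x, 0 ≤ x → 0 ≤ rate x)
    (hint : IntervalIntegrable rate volume 0 t) : IsFiniteMeasure (meanMeasure rate t) := by
  refine ⟨?_⟩
  rw [← union_compl_self (Icc 0 (t : ℝ))]
  refine (measure_union_le _ _).trans_lt ?_
  rw [meanMeasure_compl, add_zero, meanMeasure_apply h0 hint measurableSet_Icc le_rfl]
  exact ENNReal.ofReal_lt_top

/-- A set is null for a measure with a density exactly when the part of it where the density is
nonzero is null; this is the source of the condition `rate x ≠ 0`. -/
lemma ae_meanMeasure_iff (h0 : ∀ x, 0 ≤ x → 0 ≤ rate x)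
    (hint : IntervalIntegrable rate volume 0 t) {p : ℝ → Prop} :
    (∀ᵐ x ∂(meanMeasure rate t), p x) ↔
      ∀ᵐ x ∂(volume.restrict (Icc (0 : ℝ) t)), rate x ≠ 0 → p x := by
  rw [meanMeasure, ae_withDensity_iff' (aemeasurable_rate hint).coe_nnreal_ennreal]
  refine eventually_congr ?_
  filter_upwards [ae_restrict_mem measurableSet_Icc] with x hx
  have : ((rate x).toNNReal : ℝ≥0∞) ≠ 0 ↔ rate x ≠ 0 := by
    rw [Ne, ENNReal.coe_eq_zero, Real.toNNReal_eq_zero, (h0 x hx.1).ge_iff_eq']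
  rw [this]

lemma toNNReal_smul_ae_eq (h0 : ∀ x, 0 ≤ x → 0 ≤ rate x) (g : ℝ → ℂ) :
    (fun x => (rate x).toNNReal • g x) =ᵐ[volume.restrict (Icc (0 : ℝ) t)]
      fun x => (rate x : ℂ) * g x := by
  filter_upwards [ae_restrict_mem measurableSet_Icc] with x hx
  rw [NNReal.smul_def, Real.coe_toNNReal _ (h0 x hx.1), Complex.real_smul]

lemma integrable_meanMeasure_iff (h0 : ∀ x, 0 ≤ x → 0 ≤ rate x)
    (hint : IntervalIntegrable rate volume 0 t) {g : ℝ → ℂ} :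
    Integrable g (meanMeasure rate t) ↔
      IntervalIntegrable (fun x => (rate x : ℂ) * g x) volume 0 t := by
  rw [meanMeasure, integrable_withDensity_iff_integrable_smul₀ (aemeasurable_rate hint),
    intervalIntegrable_iff_integrableOn_Icc_of_le t.coe_nonneg]
  exact integrable_congr (toNNReal_smul_ae_eq h0 g)

lemma integral_meanMeasure (h0 : ∀ x, 0 ≤ x → 0 ≤ rate x)
    (hint : IntervalIntegrable rate volume 0 t) (g : ℝ → ℂ) :
    ∫ x, g x ∂(meanMeasure rate t) = ∫ x in (0 : ℝ)..t, (rate x : ℂ) * g x := by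
  rw [meanMeasure, integral_withDensity_eq_integral_smul₀ (aemeasurable_rate hint),
    integral_congr_ae (toNNReal_smul_ae_eq h0 g), intervalIntegral.integral_of_le t.coe_nonneg,
    integral_Icc_eq_integral_Ioc]

lemma IsPoissonProcess.hasPoissonCounts {Ω : Type*} [MeasurableSpace Ω] {μ : Measure Ω}
    {T : ℕ → Ω → ℝ≥0∞} (h : IsPoissonProcess μ rate T) (h0 : ∀ x, 0 ≤ x → 0 ≤ rate x)
    (hint : IntervalIntegrable rate volume 0 t) :
    HasPoissonCounts μ T t (meanMeasure rate t) := by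
  intro n A k hA hAt hd
  have e : ∀ m, (meanMeasure rate t).real (A m) = ∫ x in A m, rate x := fun m => by
    rw [Measure.real, meanMeasure_apply h0 hint (hA m) (hAt m), ENNReal.toReal_ofReal]
    exact setIntegral_nonneg (hA m) fun x hx => h0 x (hAt m hx).1
  simp_rw [e]
  exact h.law n A t k hA hAt hd

end MeanMeasure

/-! ### The domain and the formula for the occupancy vector -/

namespace IsBatchNetwork

variable {Ω : Type*} [m0 : MeasurableSpace Ω] {μ : Measure Ω} [IsProbabilityMeasure μ] {J : ℕ}
  {rate : ℝ → ℝ} {ν : Measure (Fin J → ℕ)} {q : Fin J → Fin J → ℝ → ℝ} {T : ℕ → Ω → ℝ≥0∞}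
  {B : ℕ → Ω → Fin J → ℕ} {X : ℕ → Fin J → ℕ → ℝ≥0 → Ω → Option (Fin J)}

lemma ae_finite_arrivals (h : IsBatchNetwork μ rate ν q T B X) (h0 : ∀ x, 0 ≤ x → 0 ≤ rate x)
    {t : ℝ≥0} (hint : IntervalIntegrable rate volume 0 t) :
    ∀ᵐ ω ∂μ, {i | T i ω ≤ (t : ℝ≥0∞)}.Finite :=
  (h.arrivals.hasPoissonCounts h0 hint).ae_finite h.arrivals.measurable

/-- Tonelli over arrivals and the remaining sources makes the absolute moment the mean of a product
of masses over the Poisson points, to which the finiteness criterion applies. -/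
lemma mem_pgfDomain_occupancy_iff (h : IsBatchNetwork μ rate ν q T B X)
    (h0 : ∀ x, 0 ≤ x → 0 ≤ rate x) {t : ℝ≥0} (hint : IntervalIntegrable rate volume 0 t)
    (z : Fin J → ℂ) : z ∈ pgfDomain μ (occupancy T B X t) ↔
      ∫⁻ x, batchMass μ B X t z x ∂(meanMeasure rate t) < ∞ := by
  have := isFiniteMeasure_meanMeasure h0 hint
  have hid := (h.identDistrib_occupancy (h.ae_finite_arrivals h0 hint))
  have hid1 := hid.comp (u := fun n : Fin J → ℕ => ∏ k, z k ^ n k) .of_discrete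
  have hid2 := hid.comp (u := fun n : Fin J → ℕ => ‖∏ k, z k ^ n k‖ₑ) .of_discrete
  have e : ∫⁻ ω, ‖∏ k, z k ^ occupancy T B X t ω k‖ₑ ∂μ =
      ∫⁻ ω, ∏ i ∈ arrived t (fun i => T i ω), batchMass μ B X t z (T i ω).toReal ∂μ := by
    have := hid2.lintegral_eq
    simp only [Function.comp_def] at this
    rw [this, lintegral_prod
      (fun p => ‖∏ k, z k ^ totalOccupancy B X t (fun i => T i p.1) p.2 k‖ₑ) hid2.aemeasurable_snd]
    simp_rw [h.lintegral_totalOccupancy]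
  rw [← (h.arrivals.hasPoissonCounts h0 hint).lintegral_prod_lt_top_iff h.arrivals.measurable
    meanMeasure_compl (h.measurable_batchMass t z), ← e]
  exact ⟨fun hz => hz.2, fun hz => ⟨hid1.aemeasurable_fst.aestronglyMeasurable, hz⟩⟩

lemma integrable_batchMean (h : IsBatchNetwork μ rate ν q T B X)
    {t : ℝ≥0} {z : Fin J → ℂ}
    (hz : ∫⁻ x, batchMass μ B X t z x ∂(meanMeasure rate t) < ∞) :
    Integrable (batchMean μ B X t z) (meanMeasure rate t) :=
  ⟨(h.measurable_batchMean t z).aestronglyMeasurable,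
    lt_of_le_of_lt (lintegral_mono fun _ => enorm_integral_le_lintegral_enorm _) hz⟩

lemma pgf_occupancy (h : IsBatchNetwork μ rate ν q T B X)
    (h0 : ∀ x, 0 ≤ x → 0 ≤ rate x) {t : ℝ≥0} (hint : IntervalIntegrable rate volume 0 t)
    {z : Fin J → ℂ} (hz : z ∈ pgfDomain μ (occupancy T B X t)) :
    pgf μ (occupancy T B X t) z =
      Complex.exp (∫ x, (batchMean μ B X t z x - 1) ∂(meanMeasure rate t)) := by
  have := isFiniteMeasure_meanMeasure h0 hint
  have hid := (h.identDistrib_occupancy (h.ae_finite_arrivals h0 hint)).comp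
    (u := fun n : Fin J → ℕ => ∏ k, z k ^ n k) .of_discrete
  have e := hid.integral_eq
  simp only [Function.comp_def] at e
  rw [← (h.arrivals.hasPoissonCounts h0 hint).integral_prod h.arrivals.measurable
    meanMeasure_compl (h.measurable_batchMean t z)
    (h.integrable_batchMean ((h.mem_pgfDomain_occupancy_iff h0 hint z).1 hz)), pgf, e,
    integral_prod (fun p => ∏ k, z k ^ totalOccupancy B X t (fun i => T i p.1) p.2 k)
      (hid.integrable_iff.1 hz)]
  simp_rw [h.integral_totalOccupancy]

lemma coe_sub_toNNReal {t : ℝ≥0} {x : ℝ} (hx : x ∈ Icc (0 : ℝ) t) :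
    ((t - x.toNNReal : ℝ≥0) : ℝ) = t - x := by
  rw [NNReal.coe_sub (Real.toNNReal_le_iff_le_coe.2 hx.2), Real.coe_toNNReal _ hx.1]

lemma batchMass_eq (h : IsBatchNetwork μ rate ν q T B X) {t : ℝ≥0} {x : ℝ}
    (hx : x ∈ Icc (0 : ℝ) t) (z : Fin J → ℂ) : batchMass μ B X t z x =
      ∫⁻ n, ‖∏ j, routed q (t - x) (fun k => (‖z k‖ : ℂ)) j ^ n j‖ₑ ∂ν := by
  rw [batchMass, h.lintegral_batchOccupancy, coe_sub_toNNReal hx]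

lemma batchMass_lt_top_iff (h : IsBatchNetwork μ rate ν q T B X) {t : ℝ≥0} {x : ℝ}
    (hx : x ∈ Icc (0 : ℝ) t) (z : Fin J → ℂ) : batchMass μ B X t z x < ∞ ↔
      routed q (t - x) (fun k => (‖z k‖ : ℂ)) ∈ pgfDomain ν id := by
  rw [h.batchMass_eq hx]
  exact ⟨fun hz => ⟨Measurable.of_discrete.aestronglyMeasurable, hz⟩, fun hz => hz.2⟩

lemma batchMean_eq (h : IsBatchNetwork μ rate ν q T B X) {t : ℝ≥0} {x : ℝ}
    (hx : x ∈ Icc (0 : ℝ) t) {z : Fin J → ℂ}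
    (hz : routed q (t - x) (fun k => (‖z k‖ : ℂ)) ∈ pgfDomain ν id) :
    batchMean μ B X t z x = pgf ν id (routed q (t - x) z) := by
  rw [← coe_sub_toNNReal hx] at hz ⊢
  exact h.integral_batchOccupancy _ _ _ ((h.integrable_batchOccupancy_iff _ _ _).2 hz)

/-- All coordinates of `w(t - x, |z|)` are nonnegative reals, so the generating function there
equals its absolute version. -/
lemma enorm_pgf_routed_norm (h : IsBatchNetwork μ rate ν q T B X) {t : ℝ≥0} {x : ℝ}
    (hx : x ∈ Icc (0 : ℝ) t) {z : Fin J → ℂ}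
    (hz : routed q (t - x) (fun k => (‖z k‖ : ℂ)) ∈ pgfDomain ν id) :
    ‖pgf ν id (routed q (t - x) fun k => (‖z k‖ : ℂ))‖ₑ = batchMass μ B X t z x := by
  have hr : ∀ j, routed q (t - x) (fun k => (‖z k‖ : ℂ)) j =
      (‖routed q (t - x) (fun k => (‖z k‖ : ℂ)) j‖ : ℂ) := fun j => by
    rw [← coe_sub_toNNReal hx, h.routed_norm_eq, Complex.norm_real,
      Real.norm_of_nonneg (integral_nonneg fun _ => norm_nonneg _)]
  have e : pgf ν id (routed q (t - x) fun k => (‖z k‖ : ℂ)) =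
      ((∫ n, ‖∏ j, routed q (t - x) (fun k => (‖z k‖ : ℂ)) j ^ n j‖ ∂ν : ℝ) : ℂ) := by
    rw [pgf, ← integral_complex_ofReal]
    refine integral_congr_ae (Eventually.of_forall fun n => ?_)
    simp only [norm_prod, norm_pow, Complex.ofReal_prod, Complex.ofReal_pow, ← hr, id]
  have hz' := ofReal_integral_norm_eq_lintegral_enorm hz
  simp only [id] at hz'
  rw [h.batchMass_eq hx, e, ← hz', ← ofReal_norm, Complex.norm_real, Real.norm_of_nonneg (integral_nonneg fun _ => norm_nonneg _)]

lemma mem_pgfDomain_of_norm_le {w w' : Fin J → ℂ} (hw : w' ∈ pgfDomain ν id)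
    (hle : ∀ j, ‖w j‖ ≤ ‖w' j‖) : w ∈ pgfDomain ν id := by
  refine Integrable.mono hw Measurable.of_discrete.aestronglyMeasurable
    (Eventually.of_forall fun n => ?_)
  simp only [norm_prod, norm_pow]
  exact Finset.prod_le_prod (fun j _ => by positivity) fun j _ =>
    pow_le_pow_left₀ (norm_nonneg _) (hle j) _

lemma routed_mem_pgfDomain (h : IsBatchNetwork μ rate ν q T B X) {t : ℝ≥0} {x : ℝ}
    (hx : x ∈ Icc (0 : ℝ) t) {z : Fin J → ℂ}
    (hz : routed q (t - x) (fun k => (‖z k‖ : ℂ)) ∈ pgfDomain ν id) :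
    routed q (t - x) z ∈ pgfDomain ν id := by
  refine mem_pgfDomain_of_norm_le hz fun j => ?_
  rw [← coe_sub_toNNReal hx]
  exact h.norm_routed_le j _ z

/-- The generating function of a batch is bounded on a polydisc of equal radii `r ≥ 1`. -/
lemma batchMass_le (h : IsBatchNetwork μ rate ν q T B X) {t : ℝ≥0} {r : ℝ} (hr : 1 ≤ r)
    {z : Fin J → ℂ} (hz : ∀ k, ‖z k‖ ≤ r) (x : ℝ) :
    batchMass μ B X t z x ≤ ∫⁻ n, ‖∏ j, (r : ℂ) ^ id n j‖ₑ ∂ν := by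
  rw [batchMass, h.lintegral_batchOccupancy]
  refine lintegral_mono fun n => ?_
  simp only [← ofReal_norm, norm_prod, norm_pow]
  refine ENNReal.ofReal_le_ofReal (Finset.prod_le_prod (fun j _ => by positivity) fun j _ =>
    pow_le_pow_left₀ (norm_nonneg _) ?_ _)
  rw [h.routed_norm_eq, Complex.norm_real, Complex.norm_real,
    Real.norm_of_nonneg (integral_nonneg fun _ => norm_nonneg _), Real.norm_of_nonneg (by linarith)]
  refine (integral_mono_of_nonneg (Eventually.of_forall fun _ => norm_nonneg _)
    (integrable_const r) (Eventually.of_forall fun ω => ?_)).trans_eq (by simp)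
  change ‖placeWeight z _‖ ≤ r
  -- A customer who has left contributes 1, hence the requirement `1 ≤ r`.
  cases X 0 j 0 _ ω with
  | none => simpa [placeWeight] using hr
  | some k => simpa [placeWeight] using hz k

lemma polydisc_subset_pgfDomain (h : IsBatchNetwork μ rate ν q T B X)
    (h0 : ∀ x, 0 ≤ x → 0 ≤ rate x) {t : ℝ≥0} (hint : IntervalIntegrable rate volume 0 t)
    {r : ℝ} (hr : 1 ≤ r) (hrd : (fun _ => (r : ℂ)) ∈ pgfDomain ν id) {z : Fin J → ℂ}
    (hz : ∀ k, ‖z k‖ ≤ r) : z ∈ pgfDomain μ (occupancy T B X t) := by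
  have := isFiniteMeasure_meanMeasure h0 hint
  rw [h.mem_pgfDomain_occupancy_iff h0 hint]
  refine (lintegral_mono fun x => h.batchMass_le hr hz x).trans_lt ?_
  rw [lintegral_const]
  exact ENNReal.mul_lt_top hrd.2 (measure_lt_top _ _)

lemma ae_routed_mem (h : IsBatchNetwork μ rate ν q T B X)
    {t : ℝ≥0} {z : Fin J → ℂ} (hz : ∫⁻ x, batchMass μ B X t z x ∂(meanMeasure rate t) < ∞) :
    ∀ᵐ x ∂(meanMeasure rate t), x ∈ Icc (0 : ℝ) t ∧
      routed q (t - x) (fun k => (‖z k‖ : ℂ)) ∈ pgfDomain ν id := by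
  filter_upwards [ae_meanMeasure_mem, ae_lt_top (h.measurable_batchMass t z) hz.ne] with x hx hlt
  exact ⟨hx, (h.batchMass_lt_top_iff hx z).1 hlt⟩

/-- The almost everywhere condition cannot be dropped: where the moment diverges, `pgf` takes the
default value 0, and integrability of `rate * pgf` alone would not detect it. -/
lemma lintegral_batchMass_lt_top_iff (h : IsBatchNetwork μ rate ν q T B X)
    (h0 : ∀ x, 0 ≤ x → 0 ≤ rate x) {t : ℝ≥0} (hint : IntervalIntegrable rate volume 0 t)
    (z : Fin J → ℂ) : ∫⁻ x, batchMass μ B X t z x ∂(meanMeasure rate t) < ∞ ↔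
      (∀ᵐ x ∂(volume.restrict (Icc (0 : ℝ) t)), rate x ≠ 0 →
        routed q (t - x) (fun k => (‖z k‖ : ℂ)) ∈ pgfDomain ν id) ∧
      IntervalIntegrable (fun x : ℝ => (rate x : ℂ) *
        pgf ν id (routed q (t - x) (fun k => (‖z k‖ : ℂ)))) volume 0 t := by
  rw [← ae_meanMeasure_iff h0 hint, ← integrable_meanMeasure_iff h0 hint]
  constructor
  · intro hz
    have hae := h.ae_routed_mem hz
    refine ⟨hae.mono fun x hx => hx.2, ?_⟩
    -- The mass depends on `z` only through `|z|`, so `batchMean` at `|z|` is integrable too, and it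
    -- is the generating function sought.
    have hz' : ∫⁻ x, batchMass μ B X t (fun k => (‖z k‖ : ℂ)) x ∂(meanMeasure rate t) < ∞ := by
      refine lt_of_eq_of_lt (lintegral_congr fun x => ?_) hz
      simp [batchMass, ← ofReal_norm]
    refine (h.integrable_batchMean hz').congr ?_
    filter_upwards [hae] with x hx
    exact h.batchMean_eq hx.1 (by simpa using hx.2)
  · rintro ⟨hae, hi⟩
    refine lt_of_eq_of_lt (lintegral_congr_ae ?_) hi.2
    filter_upwards [hae, ae_meanMeasure_mem] with x hx hxt
    exact (h.enorm_pgf_routed_norm hxt hx).symm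

end IsBatchNetwork

end QueueNetwork

end

theorem theorem3p1 {Ω : Type*} [MeasurableSpace Ω] (μ : Measure Ω) [IsProbabilityMeasure μ]
    (J : ℕ) (rate : ℝ → ℝ) (rate_nonneg : ∀ τ, 0 ≤ τ → 0 ≤ rate τ)
    (rate_integrable : ∀ b : ℝ, 0 ≤ b → IntervalIntegrable rate volume 0 b)
    (ν : Measure (Fin J → ℕ)) (q : Fin J → Fin J → ℝ → ℝ)
    (T : ℕ → Ω → ℝ≥0∞) (B : ℕ → Ω → Fin J → ℕ)
    (X : ℕ → Fin J → ℕ → ℝ≥0 → Ω → Option (Fin J))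
    (network : QueueNetwork.IsBatchNetwork μ rate ν q T B X) (t : ℝ≥0) :
    -- almost surely only finitely many batches arrive by time `t`
    (∀ᵐ ω ∂μ, {i | T i ω ≤ (t : ℝ≥0∞)}.Finite) ∧
    -- the closed unit polydisc lies in the domain of the PGF of `N(t)`
    (∀ z : Fin J → ℂ, (∀ k, ‖z k‖ ≤ 1) →
      z ∈ QueueNetwork.pgfDomain μ (QueueNetwork.occupancy T B X t)) ∧
    -- so does every polydisc of equal radii `r ≥ 1` that lies in the domain of `G_S`
    (∀ r : ℝ, 1 ≤ r → (fun _ => (r : ℂ)) ∈ QueueNetwork.pgfDomain ν id →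
      ∀ z : Fin J → ℂ, (∀ k, ‖z k‖ ≤ r) →
        z ∈ QueueNetwork.pgfDomain μ (QueueNetwork.occupancy T B X t)) ∧
    -- the exact domain of the PGF of `N(t)`
    (∀ z : Fin J → ℂ, z ∈ QueueNetwork.pgfDomain μ (QueueNetwork.occupancy T B X t) ↔
      (∀ᵐ τ ∂(volume.restrict (Icc (0 : ℝ) t)), rate τ ≠ 0 →
        QueueNetwork.routed q (t - τ) (fun k => (‖z k‖ : ℂ)) ∈ QueueNetwork.pgfDomain ν id) ∧
      IntervalIntegrable (fun τ : ℝ => (rate τ : ℂ) *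
        QueueNetwork.pgf ν id (QueueNetwork.routed q (t - τ) (fun k => (‖z k‖ : ℂ)))) volume 0 t) ∧
    -- the formula, on the whole domain of the PGF of `N(t)`
    (∀ z ∈ QueueNetwork.pgfDomain μ (QueueNetwork.occupancy T B X t),
      (∀ᵐ τ ∂(volume.restrict (Icc (0 : ℝ) t)), rate τ ≠ 0 →
        QueueNetwork.routed q (t - τ) z ∈ QueueNetwork.pgfDomain ν id) ∧
      IntervalIntegrable (fun τ : ℝ => (rate τ : ℂ) *
        (1 - QueueNetwork.pgf ν id (QueueNetwork.routed q (t - τ) z))) volume 0 t ∧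
      QueueNetwork.pgf μ (QueueNetwork.occupancy T B X t) z =
        Complex.exp (-∫ τ in (0 : ℝ)..t, (rate τ : ℂ) *
          (1 - QueueNetwork.pgf ν id (QueueNetwork.routed q (t - τ) z)))) := by
  have hint := rate_integrable t t.2
  have hdom := network.mem_pgfDomain_occupancy_iff rate_nonneg hint
  have hν : IsProbabilityMeasure ν := by
    rw [← network.law_batch 0]
    exact Measure.isProbabilityMeasure_map (network.measurable_batch 0).aemeasurable
  have := QueueNetwork.isFiniteMeasure_meanMeasure rate_nonneg hint
  refine ⟨network.ae_finite_arrivals rate_nonneg hint, fun z hz => ?_, fun r hr hrd z hz =>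
    network.polydisc_subset_pgfDomain rate_nonneg hint hr hrd hz, fun z => ?_, fun z hz => ?_⟩
  · refine network.polydisc_subset_pgfDomain rate_nonneg hint le_rfl ?_ hz
    -- The case `r = 1`: the integrand is the constant 1 and `ν` is a probability measure.
    simp [QueueNetwork.pgfDomain]
  · exact (hdom z).trans (network.lintegral_batchMass_lt_top_iff rate_nonneg hint z)
  · have hz' := (hdom z).1 hz
    have hae := network.ae_routed_mem hz'
    have hcongr : (fun x => 1 - QueueNetwork.IsBatchNetwork.batchMean μ B X t z x)
        =ᵐ[QueueNetwork.meanMeasure rate t]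
        fun x => 1 - QueueNetwork.pgf ν id (QueueNetwork.routed q (t - x) z) := by
      filter_upwards [hae] with x hx
      rw [network.batchMean_eq hx.1 hx.2]
    refine ⟨(QueueNetwork.ae_meanMeasure_iff rate_nonneg hint).1
      (hae.mono fun x hx => network.routed_mem_pgfDomain hx.1 hx.2), ?_, ?_⟩
    · rw [← QueueNetwork.integrable_meanMeasure_iff rate_nonneg hint]
      exact ((integrable_const 1).sub (network.integrable_batchMean hz')).congr hcongr
    · rw [network.pgf_occupancy rate_nonneg hint hz,
        ← QueueNetwork.integral_meanMeasure rate_nonneg hint, ← integral_congr_ae hcongr,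
        ← integral_neg]
      simp
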